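/- **Setting.** Let $I_1,\dots,I_N\subset\mathbb R$ ($N\ge 1$) be disjoint bounded closed intervals, $I=\bigcup_i I_i$, and let $A$ be an $N\times N$ matrix with entries in $\{0,1\}$ such that for some $T\ge 1$ all entries of $A^T$ are positive. Write $i\rightsquigarrow j$ if $A_{i,j}=1$. For $i\rightsquigarrow j$ let $\phi_{i,j}:I_i\to\mathrm{Int}(I_j)$ be smooth with $0<\phi_{i,j}'\le\theta$ for a constant $\theta<1$, and assume that $\phi_{i,j}(I_i)\cap\phi_{k,l}(I_k)=\emptyset$ for $(i,j)\ne(k,l)$. An admissible word $w_{0,n}=(w_0,\dots,w_n)$ satisfies $w_k\rightsquigarrow w_{k+1}$; put $\phi_{w_{i,j}}=\phi_{w_{j-1},w_j}\circ\dots\circ\phi_{w_i,w_{i+1}}$. For every $n$ and every admissible word $w_{0,n}$ choose an arbitrary bi-infinite admissible extension $w$, and let $x_w$ be the unique point of $\bigcap_{m\ge1}\phi_{w_{-m,0}}(I_{w_{-m}})$. For continuous $g:I\to\mathbb R$ let $$g_{w_{0,n}}=\sum_{k=1}^n g(\phi_{w_{0,k}}(x_w)),\qquad Z_n(g)=\sum_{w_{0,n}}e^{g_{w_{0,n}}},\qquad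 \mathrm{Pr}(g)=\lim_{n\to\infty}\frac1n\log Z_n(g).$$ For continuous $f,g:I\to\mathbb R$ let $$f_{min}=\lim_{n}\min_{w_{0,n}}\frac1nf_{w_{0,n}},\qquad f_{max}=\lim_{n}\max_{w_{0,n}}\frac1nf_{w_{0,n}},\qquad P(n,\mathcal I)=\frac1{Z_n(g)}\sum_{w_{0,n}:\ \frac1nf_{w_{0,n}}\in\mathcal I}e^{g_{w_{0,n}}},$$ $$\Omega(t)=\lim_{\varepsilon\to0^+}\lim_{n\to\infty}\frac1n\log P(n,[t-\varepsilon,t+\varepsilon[)\qquad(\log0=-\infty),\qquad u(\beta)=\mathrm{Pr}(g+\beta f).$$ **Proposition (large deviations).** Let $f,g:I\to\mathbb R$ be continuous. The limits $\mathrm{Pr}(g)$, $u(\beta)=\mathrm{Pr}(g+\beta f)$ ($\beta\in\mathbb R$), $f_{min}$ and $f_{max}$ exist, are finite and do not depend on the chosen extensions. Let $f_{min}<t<f_{max}$ and let $v$ be the Legendre transform of $u$, $$v(t)=\sup_{\beta\in\mathbb R}\bigl(\beta t-u(\beta)\bigr).$$ The supremum is finite and attained. If $\beta(t)$ is a point at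 which $u$ is differentiable with $u'(\beta(t))=t$, then $v(t)=\beta(t)\,t-u(\beta(t))$; such a $\beta(t)$ exists if $u$ is differentiable on $\mathbb R$. Moreover, for every choice of extensions, the inner limit in the definition of $\Omega(t)$ exists in $[-\infty,\infty]$ for every $\varepsilon>0$, the outer limit exists, and $$\Omega(t)=-\mathrm{Pr}(g)-v(t).$$ -/

import Mathlib

open Set Filter Topology
open scoped ContDiff BigOperators

noncomputable section

/-- An iterated function scheme on `N ≥ 1` disjoint bounded closed intervals `I i = [a i, b i]`,
with a transitive adjacency matrix and strictly contracting, orientation preserving, smooth maps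
`φ i j : I i → Int (I j)` for `A i j = 1` whose images are pairwise disjoint.  The values of
`φ i j` outside `I i`, and `φ i j` for `A i j = 0`, play no role. -/
structure IFS (N : ℕ) where
  N_pos : 1 ≤ N
  a : Fin N → ℝ
  b : Fin N → ℝ
  a_lt_b : ∀ i, a i < b i
  disjoint : ∀ i j, i ≠ j → Disjoint (Icc (a i) (b i)) (Icc (a j) (b j))
  A : Matrix (Fin N) (Fin N) ℕ
  A_zero_one : ∀ i j, A i j = 0 ∨ A i j = 1
  transitive : ∃ T : ℕ, 1 ≤ T ∧ ∀ i j, 0 < (A ^ T) i j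
  φ : Fin N → Fin N → ℝ → ℝ
  φ_smooth : ∀ i j, A i j = 1 → ContDiffOn ℝ ∞ (φ i j) (Icc (a i) (b i))
  φ_mapsTo : ∀ i j, A i j = 1 →
    MapsTo (φ i j) (Icc (a i) (b i)) (interior (Icc (a j) (b j)))
  contraction : ∃ θ : ℝ, 0 < θ ∧ θ < 1 ∧ ∀ i j, A i j = 1 → ∀ x ∈ Icc (a i) (b i),
    0 < derivWithin (φ i j) (Icc (a i) (b i)) x ∧
      derivWithin (φ i j) (Icc (a i) (b i)) x ≤ θ
  separation : ∀ i j k l, A i j = 1 → A k l = 1 → (i, j) ≠ (k, l) →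
    Disjoint (φ i j '' Icc (a i) (b i)) (φ k l '' Icc (a k) (b k))

namespace IFS

variable {N : ℕ} (S : IFS N)

/-- The interval `I i`. -/
def I (i : Fin N) : Set ℝ := Icc (S.a i) (S.b i)

/-- The union `I` of the intervals. -/
def domain : Set ℝ := ⋃ i, S.I i

/-- Admissible words `w_{0,n} = (w_0, …, w_n)`, of length `n + 1`. -/
abbrev Word (n : ℕ) : Type :=
  {w : Fin (n + 1) → Fin N // ∀ k : Fin n, S.A (w k.castSucc) (w k.succ) = 1}

/-- Bi-infinite admissible words. -/
abbrev BiWord : Type := {w : ℤ → Fin N // ∀ l, S.A (w l) (w (l + 1)) = 1}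

/-- `S.comp w i k` is the composition `φ_{w_{i,i+k}}` of the `k` maps along
`w_i, w_{i+1}, …, w_{i+k}`. -/
def comp (w : S.BiWord) (i : ℤ) : ℕ → ℝ → ℝ
  | 0, x => x
  | k + 1, x => S.φ (w.1 (i + k)) (w.1 (i + k + 1)) (comp w i k x)

/-- The cylinder `I_{w_{-n,0}} = φ_{w_{-n,0}} (I_{w_{-n}})`. -/
def cylinder (w : S.BiWord) (n : ℕ) : Set ℝ :=
  S.comp w (-(n : ℤ)) n '' S.I (w.1 (-(n : ℤ)))

theorem φ_mapsTo_I {i j : Fin N} (h : S.A i j = 1) : MapsTo (S.φ i j) (S.I i) (S.I j) :=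
  fun _ hx => interior_subset (S.φ_mapsTo i j h hx)

theorem comp_mapsTo (w : S.BiWord) (i : ℤ) (k : ℕ) :
    MapsTo (S.comp w i k) (S.I (w.1 i)) (S.I (w.1 (i + k))) := by
  induction k with
  | zero => intro x hx; simpa [comp] using hx
  | succ k ih =>
    intro x hx
    have h := S.φ_mapsTo_I (w.2 (i + k)) (ih hx)
    have e : i + ((k + 1 : ℕ) : ℤ) = i + k + 1 := by push_cast; ring
    rw [e]
    exact h

theorem comp_succ' (w : S.BiWord) (i : ℤ) (k : ℕ) (x : ℝ) :
    S.comp w i (k + 1) x = S.comp w (i + 1) k (S.φ (w.1 i) (w.1 (i + 1)) x) := by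
  induction k with
  | zero => simp [comp]
  | succ k ih =>
    have e : i + ((k + 1 : ℕ) : ℤ) = i + 1 + k := by push_cast; ring
    rw [comp, ih, e]
    rfl

theorem comp_continuousOn (w : S.BiWord) (i : ℤ) (k : ℕ) :
    ContinuousOn (S.comp w i k) (S.I (w.1 i)) := by
  induction k with
  | zero => exact continuousOn_id
  | succ k ih =>
    exact (S.φ_smooth _ _ (w.2 (i + k))).continuousOn.comp ih (S.comp_mapsTo w i k)

theorem cylinder_succ_subset (w : S.BiWord) (n : ℕ) :
    S.cylinder w (n + 1) ⊆ S.cylinder w n := by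
  rintro _ ⟨x, hx, rfl⟩
  have e : (-((n + 1 : ℕ) : ℤ)) + 1 = -(n : ℤ) := by push_cast; ring
  have h := S.φ_mapsTo_I (w.2 (-((n + 1 : ℕ) : ℤ))) hx
  rw [comp_succ', e] at *
  exact ⟨_, h, rfl⟩

theorem comp_contract (w : S.BiWord) {θ : ℝ} (h0 : 0 < θ)
    (hθ : ∀ i j, S.A i j = 1 → ∀ x ∈ Icc (S.a i) (S.b i),
      0 < derivWithin (S.φ i j) (Icc (S.a i) (S.b i)) x ∧
        derivWithin (S.φ i j) (Icc (S.a i) (S.b i)) x ≤ θ)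
    (i : ℤ) (k : ℕ) {x y : ℝ} (hx : x ∈ S.I (w.1 i)) (hy : y ∈ S.I (w.1 i)) :
    |S.comp w i k x - S.comp w i k y| ≤ θ ^ k * |x - y| := by
  induction k with
  | zero => simp [comp]
  | succ k ih =>
    have h := Convex.norm_image_sub_le_of_norm_derivWithin_le (𝕜 := ℝ) (C := θ)
      (f := S.φ (w.1 (i + k)) (w.1 (i + k + 1))) (s := S.I (w.1 (i + k)))
      ((S.φ_smooth _ _ (w.2 (i + k))).differentiableOn (by simp))
      (fun z hz => by
        have := hθ _ _ (w.2 (i + k)) z hz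
        change ‖derivWithin _ (Icc _ _) z‖ ≤ θ
        rw [Real.norm_eq_abs, abs_le]
        exact ⟨by linarith [this.1], this.2⟩)
      (convex_Icc _ _) (S.comp_mapsTo w i k hy) (S.comp_mapsTo w i k hx)
    simp only [Real.norm_eq_abs] at h
    calc _ ≤ θ * |S.comp w i k x - S.comp w i k y| := h
      _ ≤ θ * (θ ^ k * |x - y|) := by gcongr
      _ = _ := by ring

/-- `⋂_{n ≥ 1} I_{w_{-n,0}}` is a single point. -/
theorem existsUnique_coding (w : S.BiWord) :
    ∃! x : ℝ, ∀ n : ℕ, 1 ≤ n → x ∈ S.cylinder w n := by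
  obtain ⟨θ, h0, h1, hθ⟩ := S.contraction
  have hc : ∀ n, IsCompact (S.cylinder w n) := fun n =>
    isCompact_Icc.image_of_continuousOn (S.comp_continuousOn w _ n)
  have hne : ∀ n, (S.cylinder w n).Nonempty := fun n =>
    (nonempty_Icc.2 (S.a_lt_b _).le).image _
  obtain ⟨x, hx⟩ := IsCompact.nonempty_iInter_of_sequence_nonempty_isCompact_isClosed
    (S.cylinder w) (S.cylinder_succ_subset w) hne (hc 0) (fun n => (hc n).isClosed)
  rw [mem_iInter] at hx
  refine ⟨x, fun n _ => hx n, fun y hy => ?_⟩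
  obtain ⟨M, hM⟩ : ∃ M : ℝ, ∀ i, S.b i - S.a i ≤ M :=
    ⟨∑ i, (S.b i - S.a i), fun i => Finset.single_le_sum
      (f := fun i => S.b i - S.a i) (fun j _ => by linarith [S.a_lt_b j]) (Finset.mem_univ i)⟩
  have key : ∀ n : ℕ, 1 ≤ n → |y - x| ≤ θ ^ n * M := by
    intro n hn
    obtain ⟨p, hp, hpy⟩ := hy n hn
    obtain ⟨q, hq, hqx⟩ := hx n
    rw [← hpy, ← hqx]
    refine (S.comp_contract w h0 hθ _ n hp hq).trans ?_
    have : |p - q| ≤ M := by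
      refine le_trans ?_ (hM (w.1 (-(n : ℤ))))
      rw [abs_le]
      constructor <;> linarith [hp.1, hp.2, hq.1, hq.2]
    gcongr
  have hlim : Tendsto (fun n : ℕ => θ ^ n * M) atTop (𝓝 0) := by
    simpa using (tendsto_pow_atTop_nhds_zero_of_lt_one h0.le h1).mul_const M
  have h : |y - x| ≤ 0 := ge_of_tendsto hlim (eventually_atTop.2 ⟨1, key⟩)
  exact sub_eq_zero.1 (abs_nonpos_iff.1 h)

/-- The point `x_w = S(w_-)`, the unique element of `⋂_{n ≥ 1} I_{w_{-n,0}}`. -/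
def point (w : S.BiWord) : ℝ := (S.existsUnique_coding w).choose

theorem point_mem (w : S.BiWord) {n : ℕ} (hn : 1 ≤ n) : S.point w ∈ S.cylinder w n :=
  (S.existsUnique_coding w).choose_spec.1 n hn

/-- A choice, for every admissible word `w_{0,n}`, of a bi-infinite admissible extension. -/
structure Extension where
  toBiWord : ∀ n : ℕ, S.Word n → S.BiWord
  agree : ∀ (n : ℕ) (w : S.Word n) (k : Fin (n + 1)), (toBiWord n w).1 ((k : ℕ) : ℤ) = w.1 k

theorem exists_succ (i : Fin N) : ∃ j, S.A i j = 1 := by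
  obtain ⟨T, hT, h⟩ := S.transitive
  obtain ⟨m, rfl⟩ : ∃ m, T = m + 1 := ⟨T - 1, by omega⟩
  by_contra hcon
  push Not at hcon
  have h0 : ∀ j, S.A i j = 0 := fun j => (S.A_zero_one i j).resolve_right (hcon j)
  have := h i i
  rw [pow_succ', Matrix.mul_apply] at this
  simp [h0] at this

theorem exists_pred (j : Fin N) : ∃ i, S.A i j = 1 := by
  obtain ⟨T, hT, h⟩ := S.transitive
  obtain ⟨m, rfl⟩ : ∃ m, T = m + 1 := ⟨T - 1, by omega⟩
  by_contra hcon
  push Not at hcon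
  have h0 : ∀ i, S.A i j = 0 := fun i => (S.A_zero_one i j).resolve_right (hcon i)
  have := h j j
  rw [pow_succ, Matrix.mul_apply] at this
  simp [h0] at this

/-- Every admissible word has a bi-infinite admissible extension. -/
theorem exists_biWord (n : ℕ) (w : S.Word n) :
    ∃ z : S.BiWord, ∀ k : Fin (n + 1), z.1 ((k : ℕ) : ℤ) = w.1 k := by
  choose s hs using S.exists_succ
  choose p hp using S.exists_pred
  let z : ℤ → Fin N := fun l =>
    if l < 0 then p^[(-l).toNat] (w.1 0)
    else if h : l.toNat < n + 1 then w.1 ⟨l.toNat, h⟩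
    else s^[l.toNat - n] (w.1 (Fin.last n))
  refine ⟨⟨z, fun l => ?_⟩, fun k => ?_⟩
  · by_cases h1 : l < 0
    · obtain ⟨m, rfl⟩ : ∃ m : ℕ, l = -((m : ℤ) + 1) := ⟨(-l - 1).toNat, by omega⟩
      have hz : z (-((m : ℤ) + 1)) = p (p^[m] (w.1 0)) := by
        simp only [z, if_pos h1]
        rw [show (-(-((m : ℤ) + 1))).toNat = m + 1 by omega, Function.iterate_succ_apply']
      have hz' : z (-((m : ℤ) + 1) + 1) = p^[m] (w.1 0) := by
        by_cases hm : m = 0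
        · subst hm; simp [z]
        · simp only [z]
          rw [if_pos (by omega), show (-(-((m : ℤ) + 1) + 1)).toNat = m by omega]
      rw [hz, hz']
      exact hp _
    · obtain ⟨m, rfl⟩ : ∃ m : ℕ, l = m := ⟨l.toNat, by omega⟩
      by_cases h2 : m < n
      · have hz : z m = w.1 (Fin.castSucc ⟨m, h2⟩) := by
          simp only [z]
          rw [if_neg (by omega), dif_pos (by omega)]
          rfl
        have hz' : z ((m : ℤ) + 1) = w.1 (Fin.succ ⟨m, h2⟩) := by
          simp only [z]
          rw [if_neg (by omega), dif_pos (by omega)]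
          congr 1
        rw [hz, hz']
        exact w.2 _
      · obtain ⟨q, rfl⟩ : ∃ q, m = n + q := ⟨m - n, by omega⟩
        have hz : z ((n + q : ℕ) : ℤ) = s^[q] (w.1 (Fin.last n)) := by
          by_cases hq : q = 0
          · subst hq
            simp only [z]
            rw [if_neg (by omega), dif_pos (by simp)]
            rfl
          · simp only [z]
            rw [if_neg (by omega), dif_neg (by omega),
              show ((n + q : ℕ) : ℤ).toNat - n = q by omega]
        have hz' : z (((n + q : ℕ) : ℤ) + 1) = s (s^[q] (w.1 (Fin.last n))) := by
          simp only [z]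
          rw [if_neg (by omega), dif_neg (by omega),
            show (((n + q : ℕ) : ℤ) + 1).toNat - n = q + 1 by omega,
            Function.iterate_succ_apply']
        rw [hz, hz']
        exact hs _
  · have := k.2
    simp only [z]
    rw [if_neg (by omega), dif_pos (by omega)]
    rfl

instance : Nonempty S.Extension := by
  choose z hz using S.exists_biWord
  exact ⟨⟨z, hz⟩⟩

/-- The Birkhoff sum `g_{w_{0,n}}(x_w) = ∑_{k=1}^n g (φ_{w_{0,k}} (x_w))`, where `w` is the chosen
extension of the word. -/
def birkhoff (e : S.Extension) (g : ℝ → ℝ) (n : ℕ) (w : S.Word n) : ℝ :=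
  ∑ k ∈ Finset.Icc 1 n, g (S.comp (e.toBiWord n w) 0 k (S.point (e.toBiWord n w)))

/-- The partition function `Z_n(g)`. -/
def Z (e : S.Extension) (g : ℝ → ℝ) (n : ℕ) : ℝ :=
  ∑ w : S.Word n, Real.exp (S.birkhoff e g n w)

/-- `p` is the topological pressure of `g`: for every choice of extensions,
`p = lim (1/n) log Z_n(g)`. -/
def HasPressure (g : ℝ → ℝ) (p : ℝ) : Prop :=
  ∀ e : S.Extension, Tendsto (fun n : ℕ => (1 / (n : ℝ)) * Real.log (S.Z e g n)) atTop (𝓝 p)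

/-- The topological pressure `Pr(g)`. -/
def pressure (g : ℝ → ℝ) : ℝ := Classical.epsilon (S.HasPressure g)

/-- The probability `p_g(w_{0,n})`. -/
def prob (e : S.Extension) (g : ℝ → ℝ) (n : ℕ) (w : S.Word n) : ℝ :=
  Real.exp (S.birkhoff e g n w) / S.Z e g n

/-- `m` is the limit of the least Birkhoff averages, for every choice of extensions. -/
def HasMinAverage (f : ℝ → ℝ) (m : ℝ) : Prop :=
  ∀ e : S.Extension,
    Tendsto (fun n : ℕ => ⨅ w : S.Word n, (1 / (n : ℝ)) * S.birkhoff e f n w) atTop (𝓝 m)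

/-- `m` is the limit of the greatest Birkhoff averages, for every choice of extensions. -/
def HasMaxAverage (f : ℝ → ℝ) (m : ℝ) : Prop :=
  ∀ e : S.Extension,
    Tendsto (fun n : ℕ => ⨆ w : S.Word n, (1 / (n : ℝ)) * S.birkhoff e f n w) atTop (𝓝 m)

/-- `f_min`. -/
def fMin (f : ℝ → ℝ) : ℝ := Classical.epsilon (S.HasMinAverage f)

/-- `f_max`. -/
def fMax (f : ℝ → ℝ) : ℝ := Classical.epsilon (S.HasMaxAverage f)

open Classical in
/-- `P(n, J)`: the `p_g`-probability that the Birkhoff average of `f` lies in `J`. -/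
def probAverage (e : S.Extension) (f g : ℝ → ℝ) (n : ℕ) (J : Set ℝ) : ℝ :=
  ∑ w : S.Word n, if (1 / (n : ℝ)) * S.birkhoff e f n w ∈ J then S.prob e g n w else 0

/-- `Ω(t) = c`: for every choice of extensions, the limits
`r ε = lim_n (1/n) log P(n, [t - ε, t + ε[)` exist in `[-∞, ∞]` for all `ε > 0` (with
`log 0 = -∞`), and `r ε` tends to `c` as `ε → 0⁺`. -/
def HasRate (f g : ℝ → ℝ) (t : ℝ) (c : EReal) : Prop :=
  ∀ e : S.Extension, ∃ r : ℝ → EReal,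
    (∀ ε : ℝ, 0 < ε → Tendsto (fun n : ℕ => ((1 / (n : ℝ) : ℝ) : EReal) *
      ENNReal.log (ENNReal.ofReal (S.probAverage e f g n (Ico (t - ε) (t + ε)))))
      atTop (𝓝 (r ε))) ∧
    Tendsto r (𝓝[>] 0) (𝓝 c)

/-- The function `u(β) = Pr(g + β f)`. -/
def u (f g : ℝ → ℝ) (β : ℝ) : ℝ := S.pressure (fun x => g x + β * f x)

end IFS

/-- The Legendre transform `sup_β (β t - u(β))` of a function `u : ℝ → ℝ` at `t`, where the
supremum is finite. -/
def legendre (u : ℝ → ℝ) (t : ℝ) : ℝ := ⨆ β : ℝ, (β * t - u β)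

end

/-! Contraction makes the Birkhoff sum of a continuous function along a word insensitive, up to an
error `R n = o(n)`, to the starting point of the orbit (`exists_isVariation`). All choices of
extensions therefore have the same limits as the sums started at left endpoints. Cutting a word in
two makes the logarithms of the partition functions and the maxima of the sums subadditive up to `R
n`, and a Fekete argument yields the pressures, `fMax` and, through `-f`, `fMin`.

The function `u` is a limit of convex functions of `β` with a common Lipschitz constant. One
extremal word per length bounds `u` below by lines of slopes `fMax` and `fMin`, so `β * t - u β`
tends to `-∞` at both ends and its supremum is attained.

The upper bound of large deviations is the exponential Markov inequality on half-lines, combined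
with compactness (`exists_eventually_ZOn_le`). The lower bound has to work without differentiability
of `u`. At a finite length `n` the partition function is smooth and coercive in the tilt, so some
tilt gives the Birkhoff sum the mean `n * s` exactly (`exists_tilt_mean_eq_zero`), and these tilts
stay bounded in `n` (`exists_mean_eq`). Transitivity allows such blocks to be concatenated freely;
by Chebyshev's inequality half of the product weight sits on tuples whose average is near `s`, and
removing the tilt there costs little (`le_sum_words_of_mean_eq`). The resulting rate is nearly `u β
- β * s`, which is at least `-v(s)`.

The mass of a window thus has as rate the supremum of `-v` over the interior of the window. By
concavity boundary points add nothing, so the limit in `n` exists for half-open windows. Shrinking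
the window gives `-v(t)`, and normalizing by `Z` subtracts the pressure of `g`. -/

noncomputable section

namespace IFS

variable {N : ℕ} (S : IFS N)

/-! ### Orbits along an itinerary and bounded variation of Birkhoff sums -/

/-- One-sided infinite admissible sequences. -/
abbrev Seq : Type := {x : ℕ → Fin N // ∀ k, S.A (x k) (x (k + 1)) = 1}

/-- The orbit of `p` under the maps along the sequence `x`. -/
def orbit (x : ℕ → Fin N) (p : ℝ) : ℕ → ℝ
  | 0 => p
  | k + 1 => S.φ (x k) (x (k + 1)) (orbit x p k)

theorem orbit_add (x : ℕ → Fin N) (p : ℝ) (a k : ℕ) :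
    S.orbit x p (a + k) = S.orbit (fun l => x (a + l)) (S.orbit x p a) k := by
  induction k with
  | zero => rfl
  | succ k ih =>
    change S.φ (x (a + k)) (x (a + k + 1)) (S.orbit x p (a + k)) = _
    rw [ih]
    rfl

theorem orbit_congr {x y : ℕ → Fin N} (p : ℝ) {k : ℕ} (h : ∀ l ≤ k, x l = y l) :
    S.orbit x p k = S.orbit y p k := by
  induction k with
  | zero => rfl
  | succ k ih =>
    simp only [orbit]
    rw [ih fun l hl => h l (by omega), h k (by omega), h (k + 1) le_rfl]

theorem orbit_mem (x : S.Seq) {p : ℝ} (hp : p ∈ S.I (x.1 0)) (k : ℕ) :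
    S.orbit x.1 p k ∈ S.I (x.1 k) := by
  induction k with
  | zero => exact hp
  | succ k ih => exact S.φ_mapsTo_I (x.2 k) ih

theorem I_subset_domain (i : Fin N) : S.I i ⊆ S.domain := subset_iUnion S.I i

theorem left_mem (i : Fin N) : S.a i ∈ S.I i := left_mem_Icc.2 (S.a_lt_b i).le

theorem isCompact_domain : IsCompact S.domain := isCompact_iUnion fun _ => isCompact_Icc

theorem exists_orbit_contract : ∃ θ M : ℝ, 0 < θ ∧ θ < 1 ∧
    ∀ (x : S.Seq) (p q : ℝ), p ∈ S.I (x.1 0) → q ∈ S.I (x.1 0) → ∀ k,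
      |S.orbit x.1 p k - S.orbit x.1 q k| ≤ θ ^ k * M := by
  obtain ⟨θ, h0, h1, hθ⟩ := S.contraction
  obtain ⟨M, hM⟩ : ∃ M : ℝ, ∀ i, S.b i - S.a i ≤ M :=
    ⟨∑ i, (S.b i - S.a i), fun i => Finset.single_le_sum
      (f := fun i => S.b i - S.a i) (fun j _ => by linarith [S.a_lt_b j]) (Finset.mem_univ i)⟩
  refine ⟨θ, M, h0, h1, fun x p q hp hq k => ?_⟩
  induction k with
  | zero =>
    have := hM (x.1 0)
    simp only [orbit, pow_zero, one_mul]
    rw [abs_le]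
    constructor <;> linarith [hp.1, hp.2, hq.1, hq.2]
  | succ k ih =>
    have h := Convex.norm_image_sub_le_of_norm_derivWithin_le (𝕜 := ℝ) (C := θ)
      (f := S.φ (x.1 k) (x.1 (k + 1))) (s := S.I (x.1 k))
      ((S.φ_smooth _ _ (x.2 k)).differentiableOn (by simp))
      (fun z hz => by
        have := hθ _ _ (x.2 k) z hz
        change ‖derivWithin _ (Icc _ _) z‖ ≤ θ
        rw [Real.norm_eq_abs, abs_le]
        exact ⟨by linarith [this.1], this.2⟩)
      (convex_Icc _ _) (S.orbit_mem x hq k) (S.orbit_mem x hp k)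
    simp only [Real.norm_eq_abs] at h
    calc _ ≤ θ * |S.orbit x.1 p k - S.orbit x.1 q k| := h
      _ ≤ θ * (θ ^ k * M) := by gcongr
      _ = _ := by ring

/-- `R` bounds the variation of the Birkhoff sums of `f` over all orbits with the same itinerary,
and grows sublinearly. -/
structure IsVariation (f : ℝ → ℝ) (R : ℕ → ℝ) : Prop where
  tendsto : Tendsto (fun n : ℕ => R n / n) atTop (𝓝 0)
  abs_sub_le : ∀ (x : S.Seq) (p q : ℝ), p ∈ S.I (x.1 0) → q ∈ S.I (x.1 0) → ∀ n,
    |∑ l ∈ Finset.range n, f (S.orbit x.1 p (l + 1)) -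
      ∑ l ∈ Finset.range n, f (S.orbit x.1 q (l + 1))| ≤ R n

theorem exists_abs_le {f : ℝ → ℝ} (hf : ContinuousOn f S.domain) :
    ∃ C : ℝ, 0 ≤ C ∧ ∀ p ∈ S.domain, |f p| ≤ C := by
  obtain ⟨C, hC⟩ := S.isCompact_domain.exists_bound_of_continuousOn hf
  exact ⟨max C 0, le_max_right _ _, fun p hp => (hC p hp).trans (le_max_left _ _)⟩

/-- Two orbits with the same itinerary are within `θ ^ l * M` of each other at time `l`, so their
values of `f` differ by at most a modulus of continuity that tends to `0`. The partial sums of a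
null sequence are `o(n)` by Cesàro. -/
theorem exists_isVariation {f : ℝ → ℝ} (hf : ContinuousOn f S.domain) :
    ∃ R, S.IsVariation f R := by
  obtain ⟨θ, M, h0, h1, hM⟩ := S.exists_orbit_contract
  obtain ⟨C, hC0, hC⟩ := S.exists_abs_le hf
  let V : ℕ → Set ℝ := fun k =>
    {d | ∃ p ∈ S.domain, ∃ q ∈ S.domain, |p - q| ≤ θ ^ k * M ∧ d = |f p - f q|}
  have hV : ∀ k, BddAbove (V k) := by
    rintro k
    refine ⟨2 * C, ?_⟩
    rintro _ ⟨p, hp, q, hq, -, rfl⟩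
    have h1 := abs_le.1 (hC p hp)
    have h2 := abs_le.1 (hC q hq)
    rw [abs_le]
    constructor <;> linarith [h1.1, h1.2, h2.1, h2.2]
  have hω : Tendsto (fun k => sSup (V k)) atTop (𝓝 0) := by
    have huc := S.isCompact_domain.uniformContinuousOn_of_continuous hf
    rw [Metric.uniformContinuousOn_iff] at huc
    have hlim : Tendsto (fun n : ℕ => θ ^ n * M) atTop (𝓝 0) := by
      simpa using (tendsto_pow_atTop_nhds_zero_of_lt_one h0.le h1).mul_const M
    rw [Metric.tendsto_atTop]
    intro η hη
    obtain ⟨δ, hδ, huc⟩ := huc (η / 2) (by positivity)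
    obtain ⟨K, hK⟩ := eventually_atTop.1 (hlim.eventually (gt_mem_nhds hδ))
    refine ⟨K, fun k hk => ?_⟩
    have hnn : 0 ≤ sSup (V k) := by
      apply Real.sSup_nonneg
      rintro _ ⟨p, hp, q, hq, -, rfl⟩
      positivity
    have hle : sSup (V k) ≤ η / 2 := by
      apply Real.sSup_le _ (by positivity)
      rintro _ ⟨p, hp, q, hq, h, rfl⟩
      exact (huc p hp q hq (lt_of_le_of_lt h (hK k hk))).le
    rw [Real.dist_eq, sub_zero, abs_of_nonneg hnn]
    linarith
  refine ⟨fun n => ∑ l ∈ Finset.range n, sSup (V (l + 1)), ?_, fun x p q hp hq n => ?_⟩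
  · have := ((tendsto_add_atTop_iff_nat 1).2 hω).cesaro
    refine this.congr fun n => ?_
    rw [div_eq_inv_mul]
  · rw [← Finset.sum_sub_distrib]
    refine (Finset.abs_sum_le_sum_abs _ _).trans (Finset.sum_le_sum fun l _ => ?_)
    exact le_csSup (hV _) ⟨_, S.I_subset_domain _ (S.orbit_mem x hp _), _,
      S.I_subset_domain _ (S.orbit_mem x hq _), hM x p q hp hq _, rfl⟩

variable {S}

theorem IsVariation.nonneg {f : ℝ → ℝ} {R : ℕ → ℝ} (h : S.IsVariation f R) (x : S.Seq) (n : ℕ) :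
    0 ≤ R n :=
  (abs_nonneg _).trans (h.abs_sub_le x _ _ (S.left_mem _) (S.left_mem _) n)

theorem IsVariation.add_mul {f g : ℝ → ℝ} {R Q : ℕ → ℝ} (hf : S.IsVariation f R)
    (hg : S.IsVariation g Q) (β : ℝ) :
    S.IsVariation (fun x => g x + β * f x) (fun n => Q n + |β| * R n) := by
  refine ⟨?_, fun x p q hp hq n => ?_⟩
  · have := hg.tendsto.add (hf.tendsto.const_mul |β|)
    rw [mul_zero, add_zero] at this
    refine this.congr fun n => ?_
    ring
  · have h1 := hf.abs_sub_le x p q hp hq n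
    have h2 := hg.abs_sub_le x p q hp hq n
    simp only [Finset.sum_add_distrib, ← Finset.mul_sum]
    rw [add_sub_add_comm, ← mul_sub]
    refine (abs_add_le _ _).trans (add_le_add h2 ?_)
    rw [abs_mul]
    gcongr

variable (S)

/-! ### Birkhoff sums of words with a canonical starting point -/

/-- The points visited along `x`, starting from the left endpoint of the first interval. -/
def itin (x : ℕ → Fin N) (k : ℕ) : ℝ := S.orbit x (S.a (x 0)) k

/-- The sum of `f` over the points visited along `x` at the times `a + 1, …, a + n`. -/
def blockSum (f : ℝ → ℝ) (x : ℕ → Fin N) (a n : ℕ) : ℝ :=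
  ∑ l ∈ Finset.range n, f (S.itin x (a + l + 1))

theorem blockSum_add (f : ℝ → ℝ) (x : ℕ → Fin N) (a n m : ℕ) :
    S.blockSum f x a (n + m) = S.blockSum f x a n + S.blockSum f x (a + n) m := by
  simp only [blockSum, Finset.sum_range_add, add_assoc]

theorem blockSum_congr (f : ℝ → ℝ) {x y : ℕ → Fin N} {n : ℕ} (h : ∀ l ≤ n, x l = y l) :
    S.blockSum f x 0 n = S.blockSum f y 0 n := by
  refine Finset.sum_congr rfl fun l hl => ?_
  rw [Finset.mem_range] at hl
  rw [itin, itin, h 0 (by omega), S.orbit_congr _ fun j hj => h j (by omega)]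

theorem blockSum_add_mul (f g : ℝ → ℝ) (β : ℝ) (x : ℕ → Fin N) (a n : ℕ) :
    S.blockSum (fun x => g x + β * f x) x a n = S.blockSum g x a n + β * S.blockSum f x a n := by
  simp only [blockSum, Finset.sum_add_distrib, ← Finset.mul_sum]

theorem itin_mem (x : S.Seq) (k : ℕ) : S.itin x.1 k ∈ S.domain :=
  S.I_subset_domain _ (S.orbit_mem x (S.left_mem _) k)

theorem abs_blockSum_le {f : ℝ → ℝ} {C : ℝ} (hC : ∀ p ∈ S.domain, |f p| ≤ C) (x : S.Seq)
    (a n : ℕ) : |S.blockSum f x.1 a n| ≤ n * C := by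
  refine (Finset.abs_sum_le_sum_abs _ _).trans ?_
  refine (Finset.sum_le_card_nsmul _ _ C fun l _ => hC _ (S.itin_mem x _)).trans ?_
  simp

/-- The part of an infinite admissible sequence in the places `a, …, a + n`. -/
def factor (x : S.Seq) (a n : ℕ) : S.Word n :=
  ⟨fun k => x.1 (a + k), fun k => by simpa [add_assoc] using x.2 (a + k)⟩

theorem exists_seq (n : ℕ) (w : S.Word n) : ∃ x : S.Seq, S.factor x 0 n = w := by
  obtain ⟨z, hz⟩ := S.exists_biWord n w
  refine ⟨⟨fun k => z.1 k, fun k => by simpa using z.2 k⟩, Subtype.ext (funext fun k => ?_)⟩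
  simpa [factor] using hz k

/-- An infinite admissible sequence extending a given word. -/
def wordSeq {n : ℕ} (w : S.Word n) : S.Seq := (S.exists_seq n w).choose

theorem factor_wordSeq {n : ℕ} (w : S.Word n) : S.factor (S.wordSeq w) 0 n = w :=
  (S.exists_seq n w).choose_spec

theorem wordSeq_apply {n : ℕ} (w : S.Word n) {l : ℕ} (hl : l ≤ n) :
    (S.wordSeq w).1 l = w.1 ⟨l, by omega⟩ := by
  conv_rhs => rw [← S.factor_wordSeq w]
  simp [factor]

instance : Nonempty S.Seq := by
  choose s hs using S.exists_succ
  exact ⟨⟨fun k => s^[k] ⟨0, S.N_pos⟩, fun k => by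
    simp only [Function.iterate_succ_apply']
    exact hs _⟩⟩

instance (n : ℕ) : Nonempty (S.Word n) := ⟨S.factor (Classical.arbitrary S.Seq) 0 n⟩

/-- The sum of `f` along a word, starting from a left endpoint. -/
def wordSum (f : ℝ → ℝ) (n : ℕ) (w : S.Word n) : ℝ := S.blockSum f (S.wordSeq w).1 0 n

theorem wordSum_add_mul (f g : ℝ → ℝ) (β : ℝ) (n : ℕ) (w : S.Word n) :
    S.wordSum (fun x => g x + β * f x) n w = S.wordSum g n w + β * S.wordSum f n w :=
  S.blockSum_add_mul f g β _ _ _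

theorem abs_wordSum_le {f : ℝ → ℝ} {C : ℝ} (hC : ∀ p ∈ S.domain, |f p| ≤ C) (n : ℕ)
    (w : S.Word n) : |S.wordSum f n w| ≤ n * C := S.abs_blockSum_le hC _ _ _

theorem wordSum_factor (f : ℝ → ℝ) (x : S.Seq) (n : ℕ) :
    S.wordSum f n (S.factor x 0 n) = S.blockSum f x.1 0 n :=
  S.blockSum_congr f fun l hl => by simp [S.wordSeq_apply _ hl, factor]

variable {S}

/-- Restarting at time `a` from a left endpoint keeps the itinerary, so forgetting the past costs `R
n`, whatever `a` is. -/
theorem IsVariation.abs_blockSum_sub_le {f : ℝ → ℝ} {R : ℕ → ℝ} (h : S.IsVariation f R)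
    (x : S.Seq) (a n : ℕ) :
    |S.blockSum f x.1 a n - S.wordSum f n (S.factor x a n)| ≤ R n := by
  have e1 : S.blockSum f x.1 a n =
      ∑ l ∈ Finset.range n, f (S.orbit (fun l => x.1 (a + l)) (S.itin x.1 a) (l + 1)) :=
    Finset.sum_congr rfl fun l _ => by rw [itin, add_assoc, orbit_add]; rfl
  let y : S.Seq := ⟨fun l => x.1 (a + l), fun l => x.2 (a + l)⟩
  have e2 : S.factor x a n = S.factor y 0 n := by
    refine Subtype.ext (funext fun k => ?_)
    simp [factor, y]
  have e3 : S.wordSum f n (S.factor x a n) =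
      ∑ l ∈ Finset.range n, f (S.orbit y.1 (S.a (y.1 0)) (l + 1)) := by
    rw [e2, wordSum_factor]
    exact Finset.sum_congr rfl fun l _ => by rw [itin, zero_add]
  rw [e1, e3]
  exact h.abs_sub_le y _ _ (S.orbit_mem x (S.left_mem _) a) (S.left_mem _) n

theorem comp_eq_orbit (z : S.BiWord) (p : ℝ) (k : ℕ) :
    S.comp z 0 k p = S.orbit (fun l => z.1 l) p k := by
  induction k with
  | zero => rfl
  | succ k ih => simp [comp, orbit, ih]

theorem point_mem_I (z : S.BiWord) : S.point z ∈ S.I (z.1 0) := by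
  obtain ⟨q, hq, h⟩ := S.point_mem z le_rfl
  rw [← h]
  simpa using S.comp_mapsTo z _ 1 hq

theorem IsVariation.abs_birkhoff_sub_le {f : ℝ → ℝ} {R : ℕ → ℝ} (h : S.IsVariation f R)
    (e : S.Extension) (n : ℕ) (w : S.Word n) :
    |S.birkhoff e f n w - S.wordSum f n w| ≤ R n := by
  let z := e.toBiWord n w
  let y : S.Seq := ⟨fun l => z.1 l, fun l => by simpa using z.2 l⟩
  have e0 : S.factor y 0 n = w := by
    refine Subtype.ext (funext fun k => ?_)
    simpa [factor, y] using e.agree n w k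
  have e1 : S.birkhoff e f n w =
      ∑ l ∈ Finset.range n, f (S.orbit y.1 (S.point z) (l + 1)) := by
    rw [birkhoff, Finset.range_eq_Ico, Finset.sum_Ico_add' (fun l => f (S.orbit y.1 (S.point z) l))]
    refine Finset.sum_congr (by ext; simp) fun l _ => ?_
    rw [comp_eq_orbit]
  have e3 : S.wordSum f n w = ∑ l ∈ Finset.range n, f (S.orbit y.1 (S.a (y.1 0)) (l + 1)) := by
    rw [← e0, wordSum_factor]
    exact Finset.sum_congr rfl fun l _ => by rw [itin, zero_add]
  rw [e1, e3]
  exact h.abs_sub_le y _ _ (point_mem_I z) (S.left_mem _) n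

end IFS

theorem sum_comp_le_sum_of_injective {α β : Type*} [Fintype α] [Fintype β] {i : α → β}
    (hi : Function.Injective i) {ψ : β → ℝ} (hψ : ∀ b, 0 ≤ ψ b) :
    ∑ a, ψ (i a) ≤ ∑ b, ψ b := by
  classical
  rw [← Finset.sum_image (f := ψ) (s := Finset.univ) fun a _ b _ h => hi h]
  exact Finset.sum_le_univ_sum_of_nonneg hψ

/-! ### Fekete's lemma with a sublinear error -/

section Fekete

variable {a R : ℕ → ℝ}

theorem le_of_almost_subadditive (h : ∀ m n, a (m + n) ≤ a m + a n + R n) (r n q : ℕ) :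
    a (r + q * n) ≤ a r + q * (a n + R n) := by
  induction q with
  | zero => simp
  | succ q ih =>
    have := h (r + q * n) n
    rw [show r + (q + 1) * n = r + q * n + n by ring]
    push_cast
    linarith

/-- Iterating along the multiples of `n` bounds the limit by data at the single length `n`. The
lower bound of large deviations needs this at a fixed block length. -/
theorem limit_le_of_almost_subadditive (h : ∀ m n, a (m + n) ≤ a m + a n + R n) {p : ℝ}
    (hp : Tendsto (fun n : ℕ => a n / n) atTop (𝓝 p)) (n : ℕ) (hn : 1 ≤ n) :
    n * p ≤ a n + R n := by
  have hn' : (0 : ℝ) < n := by exact_mod_cast hn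
  have h1 : Tendsto (fun q : ℕ => q * n) atTop atTop := tendsto_id.atTop_mul_const' hn
  have h2 := (hp.comp h1).const_mul (n : ℝ)
  have h3 : Tendsto (fun q : ℕ => a 0 / (q : ℝ) + (a n + R n)) atTop (𝓝 (0 + (a n + R n))) :=
    (tendsto_const_div_atTop_nhds_zero_nat _).add_const _
  rw [zero_add] at h3
  refine le_of_tendsto_of_tendsto h2 h3 ?_
  filter_upwards [eventually_ge_atTop 1] with q hq
  have hq' : (0 : ℝ) < q := by exact_mod_cast hq
  have := le_of_almost_subadditive h 0 n q
  simp only [zero_add] at this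
  simp only [Function.comp]
  push_cast
  rw [show (n : ℝ) * (a (q * n) / (q * n)) = a (q * n) / q by field_simp, div_le_iff₀ hq']
  refine this.trans (le_of_eq ?_)
  field_simp

/-- The limit is the infimum of `(a n + R n) / n` over `n ≥ 1`: it is a lower bound up to `R n / n`,
and division of `m` with remainder by a nearly optimal length gives the upper bound. -/
theorem exists_limit_of_almost_subadditive (h : ∀ m n, a (m + n) ≤ a m + a n + R n)
    (hR : Tendsto (fun n : ℕ => R n / n) atTop (𝓝 0)) {C : ℝ} (hC : ∀ n : ℕ, -(n * C) ≤ a n) :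
    ∃ p, Tendsto (fun n : ℕ => a n / n) atTop (𝓝 p) := by
  obtain ⟨D, hD⟩ : BddBelow (range fun n : ℕ => R n / n) := hR.bddBelow_range
  -- The shift by one keeps the value `0` of a division by zero out of the infimum.
  let s : ℕ → ℝ := fun n => (a (n + 1) + R (n + 1)) / (n + 1 : ℕ)
  have hs : BddBelow (range s) := by
    refine ⟨-C + D, ?_⟩
    rintro _ ⟨n, rfl⟩
    have h1 : D ≤ R (n + 1) / (n + 1 : ℕ) := hD ⟨n + 1, rfl⟩
    have h2 : -C ≤ a (n + 1) / (n + 1 : ℕ) := by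
      rw [le_div_iff₀ (by positivity)]
      linarith [hC (n + 1)]
    simp only [s, add_div]
    linarith
  refine ⟨⨅ n, s n, tendsto_order.2 ⟨fun c hc => ?_, fun c hc => ?_⟩⟩
  · have := hR.eventually (gt_mem_nhds (sub_pos.2 hc))
    filter_upwards [this, eventually_ge_atTop 1] with n hn h1
    obtain ⟨m, rfl⟩ : ∃ m, n = m + 1 := ⟨n - 1, by omega⟩
    have := ciInf_le hs m
    simp only [s, add_div] at this hc hn ⊢
    linarith
  · obtain ⟨n, hn⟩ := exists_lt_of_ciInf_lt hc
    obtain ⟨K, hK⟩ : ∃ K, ∀ r < n + 1, |a r| + (n + 1) * |s n| ≤ K := by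
      obtain ⟨K, hK⟩ : ∃ K, ∀ r < n + 1, |a r| ≤ K := ⟨_, fun r hr =>
        Finset.single_le_sum (f := fun r => |a r|) (fun _ _ => abs_nonneg _)
          (Finset.mem_range.2 hr)⟩
      exact ⟨K + (n + 1) * |s n|, fun r hr => by linarith [hK r hr]⟩
    have hlim : Tendsto (fun m : ℕ => K / (m : ℝ) + s n) atTop (𝓝 (0 + s n)) :=
      (tendsto_const_div_atTop_nhds_zero_nat _).add_const _
    rw [zero_add] at hlim
    filter_upwards [hlim.eventually (gt_mem_nhds hn), eventually_ge_atTop 1] with m hm h1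
    refine lt_of_le_of_lt ?_ hm
    have hm' : (0 : ℝ) < m := by exact_mod_cast h1
    have hr := Nat.mod_lt m (Nat.succ_pos n)
    have hle := le_of_almost_subadditive h (m % (n + 1)) (n + 1) (m / (n + 1))
    rw [mul_comm, Nat.mod_add_div] at hle
    have hsn : a (n + 1) + R (n + 1) = (n + 1 : ℕ) * s n := by
      simp only [s]
      field_simp
    have hdm : ((m % (n + 1) : ℕ) : ℝ) + ((n + 1 : ℕ) : ℝ) * ((m / (n + 1) : ℕ) : ℝ) = m := by
      exact_mod_cast Nat.mod_add_div m (n + 1)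
    rw [hsn] at hle
    have hr' : ((m % (n + 1) : ℕ) : ℝ) ≤ n + 1 := by exact_mod_cast hr.le
    have h3 : ((m / (n + 1) : ℕ) : ℝ) * ((n + 1 : ℕ) * s n) =
      m * s n - ((m % (n + 1) : ℕ) : ℝ) * s n := by rw [← hdm]; ring
    have h4 : -(((m % (n + 1) : ℕ) : ℝ) * s n) ≤ (n + 1) * |s n| := by
      refine (neg_le_abs _).trans ?_
      rw [abs_mul, Nat.abs_cast]
      gcongr
    have h5 := hK _ hr
    have h6 := le_abs_self (a (m % (n + 1)))
    rw [div_le_iff₀ hm', add_mul, div_mul_cancel₀ _ hm'.ne']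
    linarith

end Fekete

namespace IFS

variable {N : ℕ} (S : IFS N)

/-! ### Existence of the pressure and of the extreme averages -/

/-- The partition function of the canonical sums along words. -/
def wordZ (h : ℝ → ℝ) (n : ℕ) : ℝ := ∑ w : S.Word n, Real.exp (S.wordSum h n w)

theorem wordZ_pos (h : ℝ → ℝ) (n : ℕ) : 0 < S.wordZ h n :=
  Finset.sum_pos (fun _ _ => Real.exp_pos _) Finset.univ_nonempty

theorem Z_pos (e : S.Extension) (h : ℝ → ℝ) (n : ℕ) : 0 < S.Z e h n :=
  Finset.sum_pos (fun _ _ => Real.exp_pos _) Finset.univ_nonempty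

theorem factor_congr {x y : S.Seq} {a n : ℕ} (h : S.factor x a n = S.factor y a n) {l : ℕ}
    (hl : l ≤ n) : x.1 (a + l) = y.1 (a + l) := by
  simpa [factor] using congrFun (congrArg Subtype.val h) ⟨l, by omega⟩

theorem word_ext {n : ℕ} {w w' : S.Word n}
    (h : ∀ l ≤ n, (S.wordSeq w).1 l = (S.wordSeq w').1 l) : w = w' := by
  refine Subtype.ext (funext fun k => ?_)
  have := h k (by omega)
  rwa [S.wordSeq_apply _ (by omega), S.wordSeq_apply _ (by omega)] at this

theorem split_injective (m n : ℕ) : Function.Injective fun w : S.Word (m + n) =>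
    (S.factor (S.wordSeq w) 0 m, S.factor (S.wordSeq w) m n) := by
  intro w w' h
  rw [Prod.mk.injEq] at h
  refine S.word_ext fun l hl => ?_
  rcases le_total l m with h1 | h1
  · simpa using S.factor_congr h.1 h1
  · obtain ⟨j, rfl⟩ := Nat.exists_eq_add_of_le h1
    exact S.factor_congr h.2 (by omega)

variable {S}

theorem IsVariation.abs_wordSum_sub_le {f : ℝ → ℝ} {R : ℕ → ℝ} (h : S.IsVariation f R)
    (m n : ℕ) (w : S.Word (m + n)) :
    |S.wordSum f (m + n) w - (S.wordSum f m (S.factor (S.wordSeq w) 0 m) +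
      S.wordSum f n (S.factor (S.wordSeq w) m n))| ≤ R n := by
  have := h.abs_blockSum_sub_le (S.wordSeq w) m n
  rw [wordSum_factor, wordSum, blockSum_add, zero_add, add_sub_add_left_eq_sub]
  exact this

/-- Cutting at place `m` is injective into pairs of words and changes the sum by at most `R n`. Only
cutting is involved, so transitivity plays no role in this inequality. -/
theorem IsVariation.log_wordZ_add_le {f : ℝ → ℝ} {R : ℕ → ℝ} (h : S.IsVariation f R)
    (m n : ℕ) : Real.log (S.wordZ f (m + n)) ≤
      Real.log (S.wordZ f m) + Real.log (S.wordZ f n) + R n := by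
  have key : S.wordZ f (m + n) ≤ S.wordZ f m * S.wordZ f n * Real.exp (R n) := by
    let ψ : S.Word m × S.Word n → ℝ := fun p => Real.exp (S.wordSum f m p.1) *
      Real.exp (S.wordSum f n p.2) * Real.exp (R n)
    calc S.wordZ f (m + n) ≤ ∑ w : S.Word (m + n),
          ψ (S.factor (S.wordSeq w) 0 m, S.factor (S.wordSeq w) m n) := by
          refine Finset.sum_le_sum fun w _ => ?_
          have := (abs_le.1 (h.abs_wordSum_sub_le m n w)).2
          simp only [ψ, ← Real.exp_add]
          rw [Real.exp_le_exp]
          linarith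
      _ ≤ ∑ p, ψ p := sum_comp_le_sum_of_injective (S.split_injective m n)
          fun p => by positivity
      _ = _ := by
          simp only [ψ]
          rw [← Finset.sum_mul, wordZ, wordZ, Fintype.sum_mul_sum, Fintype.sum_prod_type]
  have h1 := S.wordZ_pos f m
  have h2 := S.wordZ_pos f n
  rw [← Real.log_mul h1.ne' h2.ne', ← Real.log_exp (R n), ← Real.log_mul (by positivity)
    (Real.exp_pos _).ne']
  exact Real.log_le_log (S.wordZ_pos f _) key

theorem neg_le_log_wordZ {f : ℝ → ℝ} {C : ℝ} (hC : ∀ p ∈ S.domain, |f p| ≤ C) (n : ℕ) :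
    -(n * C) ≤ Real.log (S.wordZ f n) := by
  rw [Real.le_log_iff_exp_le (S.wordZ_pos f n)]
  have w : S.Word n := Classical.arbitrary _
  refine le_trans (Real.exp_le_exp.2 (abs_le.1 (S.abs_wordSum_le hC n w)).1) ?_
  exact Finset.single_le_sum (f := fun w => Real.exp (S.wordSum f n w))
    (fun _ _ => (Real.exp_pos _).le) (Finset.mem_univ w)

theorem log_sum_exp_sub_le {ι : Type*} [Fintype ι] [Nonempty ι] {F G : ι → ℝ} {r : ℝ}
    (h : ∀ i, F i ≤ G i + r) :
    Real.log (∑ i, Real.exp (F i)) ≤ Real.log (∑ i, Real.exp (G i)) + r := by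
  have hpos : ∀ F : ι → ℝ, 0 < ∑ i, Real.exp (F i) := fun F =>
    Finset.sum_pos (fun _ _ => Real.exp_pos _) Finset.univ_nonempty
  rw [← Real.log_exp r, ← Real.log_mul (hpos G).ne' (Real.exp_pos _).ne']
  refine Real.log_le_log (hpos F) ?_
  rw [Finset.sum_mul]
  refine Finset.sum_le_sum fun i _ => ?_
  rw [← Real.exp_add]
  exact Real.exp_le_exp.2 (h i)

/-- Sequences at distance `R n` have the same averages in the limit. -/
theorem tendsto_average_iff {a b R : ℕ → ℝ} (hR : Tendsto (fun n : ℕ => R n / n) atTop (𝓝 0))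
    (h : ∀ n, |a n - b n| ≤ R n) (p : ℝ) :
    Tendsto (fun n : ℕ => 1 / (n : ℝ) * a n) atTop (𝓝 p) ↔
      Tendsto (fun n : ℕ => b n / (n : ℝ)) atTop (𝓝 p) := by
  have h0 : Tendsto (fun n : ℕ => 1 / (n : ℝ) * a n - b n / (n : ℝ)) atTop (𝓝 0) := by
    refine squeeze_zero_norm (fun n => ?_) hR
    rw [Real.norm_eq_abs, one_div, ← div_eq_inv_mul, ← sub_div, abs_div, Nat.abs_cast]
    gcongr
    exact h n
  constructor
  · intro h1
    simpa using h1.sub h0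
  · intro h1
    simpa using h1.add h0

theorem IsVariation.abs_log_Z_sub_le {f : ℝ → ℝ} {R : ℕ → ℝ} (h : S.IsVariation f R)
    (e : S.Extension) (n : ℕ) :
    |Real.log (S.Z e f n) - Real.log (S.wordZ f n)| ≤ R n := by
  rw [abs_sub_le_iff]
  constructor
  · have := log_sum_exp_sub_le (F := S.birkhoff e f n) (G := S.wordSum f n) (r := R n)
      fun w => by linarith [(abs_le.1 (h.abs_birkhoff_sub_le e n w)).2]
    simp only [Z, wordZ]
    linarith
  · have := log_sum_exp_sub_le (G := S.birkhoff e f n) (F := S.wordSum f n) (r := R n)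
      fun w => by linarith [(abs_le.1 (h.abs_birkhoff_sub_le e n w)).1]
    simp only [Z, wordZ]
    linarith

/-- The Fekete limit of the canonical partition functions serves every extension at once, since the
logarithms differ by at most `R n`. -/
theorem hasPressure_pressure {h : ℝ → ℝ} (hh : ContinuousOn h S.domain) :
    S.HasPressure h (S.pressure h) := by
  obtain ⟨R, hR⟩ := S.exists_isVariation hh
  obtain ⟨C, -, hC⟩ := S.exists_abs_le hh
  obtain ⟨p, hp⟩ := exists_limit_of_almost_subadditive (fun m n => hR.log_wordZ_add_le m n)
    hR.tendsto (neg_le_log_wordZ hC)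
  refine Classical.epsilon_spec (p := S.HasPressure h) ⟨p, fun e => ?_⟩
  exact (tendsto_average_iff hR.tendsto (hR.abs_log_Z_sub_le e) p).2 hp

theorem IsVariation.tendsto_wordZ {h : ℝ → ℝ} {R : ℕ → ℝ} (hR : S.IsVariation h R) {p : ℝ}
    (hp : S.HasPressure h p) :
    Tendsto (fun n : ℕ => Real.log (S.wordZ h n) / n) atTop (𝓝 p) :=
  let e := Classical.arbitrary S.Extension
  (tendsto_average_iff hR.tendsto (hR.abs_log_Z_sub_le e) p).1 (hp e)

theorem IsVariation.mul_pressure_le {h : ℝ → ℝ} {R : ℕ → ℝ} (hR : S.IsVariation h R) {p : ℝ}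
    (hp : S.HasPressure h p) {n : ℕ} (hn : 1 ≤ n) :
    n * p ≤ Real.log (S.wordZ h n) + R n :=
  limit_le_of_almost_subadditive (fun m n => hR.log_wordZ_add_le m n) (hR.tendsto_wordZ hp) n hn

theorem IsVariation.abs_iSup_sub_le {f : ℝ → ℝ} {R : ℕ → ℝ} (h : S.IsVariation f R)
    (e : S.Extension) (n : ℕ) :
    |(⨆ w, S.birkhoff e f n w) - ⨆ w, S.wordSum f n w| ≤ R n := by
  rw [abs_sub_le_iff]
  constructor
  · rw [sub_le_iff_le_add]
    refine ciSup_le fun w => ?_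
    have := le_ciSup (finite_range (S.wordSum f n)).bddAbove w
    linarith [(abs_le.1 (h.abs_birkhoff_sub_le e n w)).2]
  · rw [sub_le_iff_le_add]
    refine ciSup_le fun w => ?_
    have := le_ciSup (finite_range (S.birkhoff e f n)).bddAbove w
    linarith [(abs_le.1 (h.abs_birkhoff_sub_le e n w)).1]

theorem exists_hasMaxAverage {f : ℝ → ℝ} (hf : ContinuousOn f S.domain) :
    ∃ m, S.HasMaxAverage f m := by
  obtain ⟨R, hR⟩ := S.exists_isVariation hf
  obtain ⟨C, -, hC⟩ := S.exists_abs_le hf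
  have hb : ∀ n, BddAbove (range (S.wordSum f n)) := fun n => (finite_range _).bddAbove
  obtain ⟨m, hm⟩ := exists_limit_of_almost_subadditive (a := fun n => ⨆ w, S.wordSum f n w)
    (fun m n => ciSup_le fun w => by
      have h1 := le_ciSup (hb m) (S.factor (S.wordSeq w) 0 m)
      have h2 := le_ciSup (hb n) (S.factor (S.wordSeq w) m n)
      linarith [(abs_le.1 (hR.abs_wordSum_sub_le m n w)).2])
    hR.tendsto
    (fun n => (abs_le.1 (S.abs_wordSum_le hC n (Classical.arbitrary _))).1.trans
      (le_ciSup (hb n) _))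
  refine ⟨m, fun e => ?_⟩
  simp_rw [← Real.mul_iSup_of_nonneg (one_div_nonneg.2 (Nat.cast_nonneg _))]
  exact (tendsto_average_iff hR.tendsto (hR.abs_iSup_sub_le e) m).2 hm

theorem hasMaxAverage_fMax {f : ℝ → ℝ} (hf : ContinuousOn f S.domain) :
    S.HasMaxAverage f (S.fMax f) :=
  Classical.epsilon_spec (p := S.HasMaxAverage f) (exists_hasMaxAverage hf)

theorem hasMinAverage_fMin {f : ℝ → ℝ} (hf : ContinuousOn f S.domain) :
    S.HasMinAverage f (S.fMin f) := by
  refine Classical.epsilon_spec (p := S.HasMinAverage f) ?_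
  obtain ⟨m, hm⟩ := exists_hasMaxAverage hf.neg
  refine ⟨-m, fun e => (hm e).neg.congr fun n => ?_⟩
  have e1 : (fun w => 1 / (n : ℝ) * S.birkhoff e (-f) n w) =
      -fun w => 1 / (n : ℝ) * S.birkhoff e f n w := by
    funext w
    simp [birkhoff]
  rw [iInf, Real.sInf_def, iSup, e1]
  congr 2
  ext y
  simp [neg_eq_iff_eq_neg]

end IFS

/-! ### Convexity and growth of `u`, and its Legendre transform -/

theorem limit_le_add_of_le {a b : ℕ → ℝ} {p q r : ℝ}
    (ha : Tendsto (fun n : ℕ => a n / n) atTop (𝓝 p))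
    (hb : Tendsto (fun n : ℕ => b n / n) atTop (𝓝 q)) (h : ∀ n, a n ≤ b n + n * r) :
    p ≤ q + r := by
  refine le_of_tendsto_of_tendsto ha (hb.add_const r) ?_
  filter_upwards [eventually_ge_atTop 1] with n hn
  have hn' : (0 : ℝ) < n := by exact_mod_cast hn
  have := h n
  rw [div_le_iff₀ hn', add_mul, div_mul_cancel₀ _ hn'.ne']
  linarith

/-- This is Hölder's inequality in logarithmic form: once both sums are normalized to `1`, convexity
of `exp` applies term by term. -/
theorem sum_exp_convex_comb_le {ι : Type*} [Fintype ι] [Nonempty ι] (F G : ι → ℝ) {s t : ℝ}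
    (hs : 0 ≤ s) (ht : 0 ≤ t) (hst : s + t = 1) :
    Real.log (∑ i, Real.exp (s * F i + t * G i)) ≤
      s * Real.log (∑ i, Real.exp (F i)) + t * Real.log (∑ i, Real.exp (G i)) := by
  have hpos : ∀ F : ι → ℝ, 0 < ∑ i, Real.exp (F i) := fun F =>
    Finset.sum_pos (fun _ _ => Real.exp_pos _) Finset.univ_nonempty
  set a := Real.log (∑ i, Real.exp (F i)) with ha
  set b := Real.log (∑ i, Real.exp (G i)) with hb
  have hone : ∀ F : ι → ℝ, ∑ i, Real.exp (F i - Real.log (∑ i, Real.exp (F i))) = 1 := by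
    intro F
    simp only [Real.exp_sub, Real.exp_log (hpos F), ← Finset.sum_div]
    exact div_self (hpos F).ne'
  rw [Real.log_le_iff_le_exp (hpos _)]
  have key : ∑ i, Real.exp (s * (F i - a) + t * (G i - b)) ≤ 1 := by
    calc _ ≤ ∑ i, (s * Real.exp (F i - a) + t * Real.exp (G i - b)) :=
          Finset.sum_le_sum fun i _ => convexOn_exp.2 (mem_univ _) (mem_univ _) hs ht hst
      _ = 1 := by
          rw [Finset.sum_add_distrib, ← Finset.mul_sum, ← Finset.mul_sum, hone, hone]
          linarith
  calc ∑ i, Real.exp (s * F i + t * G i)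
      = (∑ i, Real.exp (s * (F i - a) + t * (G i - b))) * Real.exp (s * a + t * b) := by
        rw [Finset.sum_mul]
        refine Finset.sum_congr rfl fun i _ => ?_
        rw [← Real.exp_add]
        ring_nf
    _ ≤ 1 * Real.exp (s * a + t * b) := by gcongr
    _ = _ := one_mul _

namespace IFS

variable {N : ℕ} {S : IFS N} {f g : ℝ → ℝ}

theorem hasPressure_u (hf : ContinuousOn f S.domain) (hg : ContinuousOn g S.domain) (β : ℝ) :
    S.HasPressure (fun x => g x + β * f x) (S.u f g β) :=
  hasPressure_pressure (hg.add (continuousOn_const.mul hf))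

theorem tendsto_log_wordZ (hf : ContinuousOn f S.domain) (hg : ContinuousOn g S.domain) (β : ℝ) :
    Tendsto (fun n : ℕ => Real.log (S.wordZ (fun x => g x + β * f x) n) / n) atTop
      (𝓝 (S.u f g β)) := by
  obtain ⟨R, hR⟩ := S.exists_isVariation (hg.add (continuousOn_const.mul hf) :
    ContinuousOn (fun x => g x + β * f x) S.domain)
  exact hR.tendsto_wordZ (hasPressure_u hf hg β)

theorem continuous_u (hf : ContinuousOn f S.domain) (hg : ContinuousOn g S.domain) :
    Continuous (S.u f g) := by
  obtain ⟨C, hC0, hC⟩ := S.exists_abs_le hf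
  refine (LipschitzWith.of_le_add_mul' (f := S.u f g) C fun β γ => ?_).continuous
  rw [Real.dist_eq]
  refine limit_le_add_of_le (tendsto_log_wordZ hf hg β) (tendsto_log_wordZ hf hg γ) fun n => ?_
  refine log_sum_exp_sub_le fun w => ?_
  rw [wordSum_add_mul, wordSum_add_mul]
  have h1 : (β - γ) * S.wordSum f n w ≤ n * (C * |β - γ|) := by
    refine (le_abs_self _).trans ?_
    rw [abs_mul, mul_comm, ← mul_assoc]
    gcongr
    exact S.abs_wordSum_le hC n w
  linarith

theorem convexOn_u (hf : ContinuousOn f S.domain) (hg : ContinuousOn g S.domain) :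
    ConvexOn ℝ univ (S.u f g) := by
  refine ⟨convex_univ, fun β _ γ _ s t hs ht hst => ?_⟩
  have h := ((tendsto_log_wordZ hf hg β).const_mul s).add
    ((tendsto_log_wordZ hf hg γ).const_mul t)
  refine le_of_tendsto_of_tendsto' (tendsto_log_wordZ hf hg _) h fun n => ?_
  have := sum_exp_convex_comb_le (S.wordSum (fun x => g x + β * f x) n)
    (S.wordSum (fun x => g x + γ * f x) n) hs ht hst
  rw [← mul_div_assoc, ← mul_div_assoc, ← add_div]
  refine div_le_div_of_nonneg_right (le_trans (le_of_eq ?_) this) (Nat.cast_nonneg _)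
  rw [wordZ]
  congr 1
  refine Finset.sum_congr rfl fun w _ => ?_
  simp only [wordSum_add_mul, smul_eq_mul]
  congr 1
  linear_combination (-S.wordSum g n w) * hst

theorem exists_words_tendsto_fMax (hf : ContinuousOn f S.domain) : ∃ w : ∀ n, S.Word n,
    Tendsto (fun n : ℕ => S.wordSum f n (w n) / n) atTop (𝓝 (S.fMax f)) := by
  let e := Classical.arbitrary S.Extension
  obtain ⟨R, hR⟩ := S.exists_isVariation hf
  choose w hw using fun n : ℕ =>
    exists_eq_ciSup_of_finite (f := fun w : S.Word n => 1 / (n : ℝ) * S.birkhoff e f n w)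
  refine ⟨w, (tendsto_average_iff hR.tendsto
    (fun n => hR.abs_birkhoff_sub_le e n (w n)) _).1 ?_⟩
  simpa only [hw] using hasMaxAverage_fMax hf e

theorem exists_words_tendsto_fMin (hf : ContinuousOn f S.domain) : ∃ w : ∀ n, S.Word n,
    Tendsto (fun n : ℕ => S.wordSum f n (w n) / n) atTop (𝓝 (S.fMin f)) := by
  let e := Classical.arbitrary S.Extension
  obtain ⟨R, hR⟩ := S.exists_isVariation hf
  choose w hw using fun n : ℕ =>
    exists_eq_ciInf_of_finite (f := fun w : S.Word n => 1 / (n : ℝ) * S.birkhoff e f n w)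
  refine ⟨w, (tendsto_average_iff hR.tendsto
    (fun n => hR.abs_birkhoff_sub_le e n (w n)) _).1 ?_⟩
  simpa only [hw] using hasMinAverage_fMin hf e

/-- A partition function is at least its term at `w n`. With extremal words, `κ` is `fMax` or
`fMin`, which makes `β * t - u β` tend to `-∞` at both ends. -/
theorem mul_le_u_add (hf : ContinuousOn f S.domain) (hg : ContinuousOn g S.domain) {C : ℝ}
    (hC : ∀ p ∈ S.domain, |g p| ≤ C) {w : ∀ n, S.Word n} {κ : ℝ}
    (hw : Tendsto (fun n : ℕ => S.wordSum f n (w n) / n) atTop (𝓝 κ)) (β : ℝ) :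
    β * κ ≤ S.u f g β + C := by
  have h1 := hw.const_mul β
  simp only [← mul_div_assoc] at h1
  refine limit_le_add_of_le h1 (tendsto_log_wordZ hf hg β) fun n => ?_
  have h2 := (abs_le.1 (S.abs_wordSum_le hC n (w n))).1
  have h3 : S.wordSum (fun x => g x + β * f x) n (w n) ≤
      Real.log (S.wordZ (fun x => g x + β * f x) n) := by
    rw [Real.le_log_iff_exp_le (S.wordZ_pos _ n)]
    exact Finset.single_le_sum
      (f := fun w => Real.exp (S.wordSum (fun x => g x + β * f x) n w))
      (fun _ _ => (Real.exp_pos _).le) (Finset.mem_univ (w n))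
  rw [wordSum_add_mul] at h3
  linarith

theorem exists_isMax_sub_u (hf : ContinuousOn f S.domain) (hg : ContinuousOn g S.domain) {t : ℝ}
    (h1 : S.fMin f < t) (h2 : t < S.fMax f) :
    ∃ β₀, ∀ β, β * t - S.u f g β ≤ β₀ * t - S.u f g β₀ := by
  obtain ⟨C, -, hC⟩ := S.exists_abs_le hg
  obtain ⟨w, hw⟩ := exists_words_tendsto_fMax hf
  obtain ⟨w', hw'⟩ := exists_words_tendsto_fMin hf
  refine Continuous.exists_forall_ge (f := fun β => β * t - S.u f g β)
    ((continuous_id.mul continuous_const).sub (continuous_u hf hg)) ?_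
  rw [cocompact_eq_atBot_atTop, tendsto_sup]
  constructor
  · have : Tendsto (fun β : ℝ => β * (t - S.fMin f) + C) atBot atBot :=
      tendsto_atBot_add_const_right _ _ (tendsto_id.atBot_mul_const (sub_pos.2 h1))
    refine tendsto_atBot_mono (fun β => ?_) this
    linarith [mul_le_u_add hf hg hC hw' β]
  · have : Tendsto (fun β : ℝ => β * (t - S.fMax f) + C) atTop atBot :=
      tendsto_atBot_add_const_right _ _ (tendsto_id.atTop_mul_const_of_neg (sub_neg.2 h2))
    refine tendsto_atBot_mono (fun β => ?_) this
    linarith [mul_le_u_add hf hg hC hw β]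

theorem isGreatest_legendre (hf : ContinuousOn f S.domain) (hg : ContinuousOn g S.domain) {t : ℝ}
    (h1 : S.fMin f < t) (h2 : t < S.fMax f) :
    IsGreatest (range fun β : ℝ => β * t - S.u f g β) (legendre (S.u f g) t) := by
  obtain ⟨β, hβ⟩ := exists_isMax_sub_u hf hg h1 h2
  have h : IsGreatest (range fun β : ℝ => β * t - S.u f g β) (β * t - S.u f g β) :=
    ⟨⟨β, rfl⟩, by rintro _ ⟨γ, rfl⟩; exact hβ γ⟩
  rwa [legendre, iSup, h.csSup_eq]

/-- The graph of the convex function `u` lies above its tangent line at `β`. -/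
theorem legendre_eq_of_hasDerivAt (hf : ContinuousOn f S.domain) (hg : ContinuousOn g S.domain)
    {t β : ℝ} (h : HasDerivAt (S.u f g) t β) :
    legendre (S.u f g) t = β * t - S.u f g β := by
  have hG : IsGreatest (range fun β : ℝ => β * t - S.u f g β) (β * t - S.u f g β) := by
    refine ⟨⟨β, rfl⟩, ?_⟩
    rintro _ ⟨γ, rfl⟩
    have hc := convexOn_u hf hg
    rcases lt_trichotomy β γ with hlt | rfl | hlt
    · have := hc.le_slope_of_hasDerivAt (mem_univ β) (mem_univ γ) hlt h
      rw [slope_def_field, le_div_iff₀ (sub_pos.2 hlt)] at this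
      linarith
    · exact le_rfl
    · have := hc.slope_le_of_hasDerivAt (mem_univ γ) (mem_univ β) hlt h
      rw [slope_def_field, div_le_iff₀ (sub_pos.2 hlt)] at this
      linarith
  rw [legendre, iSup, hG.csSup_eq]

theorem exists_hasDerivAt (hf : ContinuousOn f S.domain) (hg : ContinuousOn g S.domain) {t : ℝ}
    (h1 : S.fMin f < t) (h2 : t < S.fMax f) (hu : Differentiable ℝ (S.u f g)) :
    ∃ β, HasDerivAt (S.u f g) t β := by
  obtain ⟨β, hβ⟩ := exists_isMax_sub_u hf hg h1 h2
  refine ⟨β, ?_⟩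
  have hd := ((hasDerivAt_id β).mul_const t).sub (hu β).hasDerivAt
  have hmax : IsLocalMax (fun γ => γ * t - S.u f g γ) β := Eventually.of_forall hβ
  have h0 := hmax.hasDerivAt_eq_zero hd
  have : deriv (S.u f g) β = t := by linarith
  exact this ▸ (hu β).hasDerivAt

end IFS

/-! ### Exponential tilts and Chebyshev's inequality for product weights -/

/-- A finite family of weights has an exponential tilt for which a function taking both signs
has mean zero. -/
theorem exists_tilt_mean_eq_zero {ι : Type*} [Fintype ι] (G X : ι → ℝ) {i j : ι}
    (hi : 0 < X i) (hj : X j < 0) :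
    ∃ β : ℝ, ∑ k, Real.exp (G k + β * X k) * X k = 0 ∧
      ∀ γ : ℝ, ∑ k, Real.exp (G k + β * X k) ≤ ∑ k, Real.exp (G k + γ * X k) := by
  have hle : ∀ (k : ι) (β : ℝ), Real.exp (G k + β * X k) ≤ ∑ k, Real.exp (G k + β * X k) :=
    fun k β => Finset.single_le_sum (f := fun k => Real.exp (G k + β * X k))
      (fun _ _ => (Real.exp_pos _).le) (Finset.mem_univ k)
  -- The terms `i` and `j` make the sum coercive in the tilt; the mean in question is its
  -- derivative, which vanishes at a minimum.
  obtain ⟨β, hβ⟩ := Continuous.exists_forall_le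
    (f := fun β : ℝ => ∑ k, Real.exp (G k + β * X k)) (by fun_prop) (by
      rw [cocompact_eq_atBot_atTop, tendsto_sup]
      constructor
      · exact tendsto_atTop_mono (hle j) (Real.tendsto_exp_atTop.comp
          (tendsto_atTop_add_const_left _ _ (tendsto_id.atBot_mul_const_of_neg hj)))
      · exact tendsto_atTop_mono (hle i) (Real.tendsto_exp_atTop.comp
          (tendsto_atTop_add_const_left _ _ (tendsto_id.atTop_mul_const hi))))
  refine ⟨β, ?_, hβ⟩
  have hd : HasDerivAt (fun β : ℝ => ∑ k, Real.exp (G k + β * X k))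
      (∑ k, Real.exp (G k + β * X k) * X k) β := by
    refine HasDerivAt.fun_sum fun k _ => ?_
    have := (((hasDerivAt_id β).mul_const (X k)).const_add (G k)).exp
    simpa using this
  exact IsLocalMin.hasDerivAt_eq_zero (Eventually.of_forall hβ) hd

theorem sum_pi_succ {ι : Type*} [Fintype ι] {k : ℕ} (F : (Fin (k + 1) → ι) → ℝ) :
    ∑ b, F b = ∑ i, ∑ b : Fin k → ι, F (Fin.cons i b) := by
  rw [← Fintype.sum_prod_type', ← (Fin.consEquiv fun _ : Fin (k + 1) => ι).sum_comp]
  rfl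

theorem sum_pi_prod_eq_pow {ι : Type*} [Fintype ι] (q : ι → ℝ) (k : ℕ) :
    ∑ b : Fin k → ι, ∏ i, q (b i) = (∑ i, q i) ^ k := by
  rw [Finset.sum_pow', Fintype.piFinset_univ]

/-- Variances of independent centred variables add up: the cross term contains the mean, which is
zero. The weights are not normalized, hence the power of the total mass. -/
theorem sum_pi_prod_mul_sq_le {ι : Type*} [Fintype ι] {q X : ι → ℝ} {D : ℝ}
    (hq : ∀ i, 0 ≤ q i) (hX : ∀ i, |X i| ≤ D) (h0 : ∑ i, q i * X i = 0) (k : ℕ) :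
    ∑ b : Fin k → ι, (∏ i, q (b i)) * (∑ i, X (b i)) ^ 2 ≤ k * D ^ 2 * (∑ i, q i) ^ k := by
  induction k with
  | zero => simp
  | succ k ih =>
    set H := ∑ i, q i with hH
    have hHn : 0 ≤ H := Finset.sum_nonneg fun i _ => hq i
    set B := ∑ b : Fin k → ι, (∏ i, q (b i)) * ∑ i, X (b i)
    set V := ∑ b : Fin k → ι, (∏ i, q (b i)) * (∑ i, X (b i)) ^ 2
    have hV : ∑ i, q i * X i ^ 2 ≤ D ^ 2 * H := by
      rw [hH, Finset.mul_sum]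
      refine Finset.sum_le_sum fun i _ => ?_
      rw [mul_comm]
      exact mul_le_mul_of_nonneg_right (sq_le_sq' (abs_le.1 (hX i)).1 (abs_le.1 (hX i)).2) (hq i)
    have e : ∑ b : Fin (k + 1) → ι, (∏ i, q (b i)) * (∑ i, X (b i)) ^ 2 =
        (∑ i, q i * X i ^ 2) * H ^ k + 2 * (∑ i, q i * X i) * B + H * V := by
      have inner : ∀ i, ∑ b : Fin k → ι, (∏ j, q ((Fin.cons i b : Fin (k + 1) → ι) j)) *
          (∑ j, X ((Fin.cons i b : Fin (k + 1) → ι) j)) ^ 2 =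
          q i * X i ^ 2 * H ^ k + q i * X i * (2 * B) + q i * V := by
        intro i
        rw [← sum_pi_prod_eq_pow]
        simp only [B, V, Finset.mul_sum (Finset.univ : Finset (Fin k → ι)),
          ← Finset.sum_add_distrib]
        refine Finset.sum_congr rfl fun b _ => ?_
        simp only [Fin.prod_univ_succ, Fin.sum_univ_succ, Fin.cons_zero, Fin.cons_succ]
        ring
      rw [sum_pi_succ]
      simp only [inner, Finset.sum_add_distrib, ← Finset.sum_mul]
      ring
    rw [e, h0]
    have h1 : (∑ i, q i * X i ^ 2) * H ^ k ≤ D ^ 2 * H * H ^ k := by gcongr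
    have h2 : H * V ≤ H * (k * D ^ 2 * H ^ k) := by gcongr
    calc _ ≤ D ^ 2 * H * H ^ k + 2 * 0 * B + H * (k * D ^ 2 * H ^ k) := by gcongr
      _ = _ := by push_cast; ring

open Classical in
/-- Chebyshev's inequality for a sum of independent variables, in unnormalized form. -/
theorem le_sum_pi_prod_of_abs_sum_lt {ι : Type*} [Fintype ι] {q X : ι → ℝ} {D : ℝ}
    (hq : ∀ i, 0 ≤ q i) (hX : ∀ i, |X i| ≤ D) (h0 : ∑ i, q i * X i = 0) (k : ℕ) {a : ℝ}
    (ha : 0 < a) (hk : 2 * (k * D ^ 2) ≤ a ^ 2) :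
    (∑ i, q i) ^ k / 2 ≤
      ∑ b : Fin k → ι, if |∑ i, X (b i)| < a then ∏ i, q (b i) else 0 := by
  have h1 := sum_pi_prod_mul_sq_le hq hX h0 k
  set H := ∑ i, q i
  have hHn : 0 ≤ H ^ k := pow_nonneg (Finset.sum_nonneg fun i _ => hq i) _
  have h2 : ∑ b : Fin k → ι, (∏ i, q (b i)) * (∑ i, X (b i)) ^ 2 ≤ a ^ 2 / 2 * H ^ k :=
    h1.trans (mul_le_mul_of_nonneg_right (by linarith) hHn)
  have h3 : ∑ b : Fin k → ι, ∏ i, q (b i) ≤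
      ∑ b : Fin k → ι, ((if |∑ i, X (b i)| < a then ∏ i, q (b i) else 0) +
        (∏ i, q (b i)) * (∑ i, X (b i)) ^ 2 / a ^ 2) := by
    refine Finset.sum_le_sum fun b _ => ?_
    have hp : 0 ≤ ∏ i, q (b i) := Finset.prod_nonneg fun i _ => hq _
    split_ifs with h
    · have : 0 ≤ (∏ i, q (b i)) * (∑ i, X (b i)) ^ 2 / a ^ 2 := by positivity
      linarith
    · rw [zero_add, le_div_iff₀ (by positivity)]
      refine mul_le_mul_of_nonneg_left ?_ hp
      rw [← sq_abs (∑ i, X (b i))]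
      exact pow_le_pow_left₀ ha.le (not_lt.1 h) 2
  rw [sum_pi_prod_eq_pow, Finset.sum_add_distrib, ← Finset.sum_div] at h3
  have h4 : (∑ b : Fin k → ι, (∏ i, q (b i)) * (∑ i, X (b i)) ^ 2) / a ^ 2 ≤ H ^ k / 2 := by
    rw [div_le_iff₀ (by positivity)]
    linarith
  linarith

/-! ### Concatenation of words by transitivity -/

namespace IFS

variable {N : ℕ} (S : IFS N)

theorem exists_path (m : ℕ) (i j : Fin N) (h : 0 < (S.A ^ m) i j) :
    ∃ c : ℕ → Fin N, c 0 = i ∧ c m = j ∧ ∀ l < m, S.A (c l) (c (l + 1)) = 1 := by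
  induction m generalizing i with
  | zero =>
    refine ⟨fun _ => i, rfl, ?_, by simp⟩
    by_contra hij
    simp [Matrix.one_apply_ne hij] at h
  | succ m ih =>
    rw [pow_succ', Matrix.mul_apply] at h
    obtain ⟨k, -, hk⟩ := Finset.exists_ne_zero_of_sum_ne_zero h.ne'
    obtain ⟨h1, h2⟩ := mul_ne_zero_iff.1 hk
    obtain ⟨c, h3, h4, h5⟩ := ih k (Nat.pos_of_ne_zero h2)
    refine ⟨fun l => Nat.casesOn l i c, rfl, h4, fun l hl => ?_⟩
    cases l with
    | zero => simpa [h3] using (S.A_zero_one i k).resolve_left h1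
    | succ l => exact h5 l (by omega)

/-- Blocks of a fixed length can be concatenated, with connecting words of a fixed length. -/
theorem exists_concat : ∃ T : ℕ, 1 ≤ T ∧ ∀ n : ℕ, ∃ glue : (ℕ → S.Word n) → S.Seq,
    ∀ b k, S.factor (glue b) (k * (n + T)) n = b k := by
  obtain ⟨T, hT, hpos⟩ := S.transitive
  choose c hc0 hcT hc using fun i j => S.exists_path T i j (hpos i j)
  refine ⟨T, hT, fun n => ?_⟩
  -- `X b q r` is the letter at offset `r` in period `q`. A block has `n + 1` letters and a
  -- connecting path has `T` steps, so the period is `n + T`; block and path share the letter at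
  -- offset `n`.
  let X : (ℕ → S.Word n) → ℕ → ℕ → Fin N := fun b q r =>
    if h : r < n + 1 then (b q).1 ⟨r, h⟩
    else c ((b q).1 (Fin.last n)) ((b (q + 1)).1 0) (r - n)
  have hX0 : ∀ b q r, n ≤ r → X b q r =
      c ((b q).1 (Fin.last n)) ((b (q + 1)).1 0) (r - n) := by
    intro b q r hr
    simp only [X]
    split_ifs with h
    · obtain rfl : r = n := by omega
      rw [Nat.sub_self, hc0]
      rfl
    · rfl
  have hXT : ∀ b q, X b q (n + T) = X b (q + 1) 0 := by
    intro b q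
    rw [hX0 _ _ _ (by omega), Nat.add_sub_cancel_left, hcT]
    simp [X]
  have hX1 : ∀ b q r, r < n + T → S.A (X b q r) (X b q (r + 1)) = 1 := by
    intro b q r hr
    rcases lt_or_ge r n with h | h
    · simp only [X, dif_pos (show r < n + 1 by omega), dif_pos (show r + 1 < n + 1 by omega)]
      exact (b q).2 ⟨r, h⟩
    · rw [hX0 _ _ _ h, hX0 _ _ _ (by omega), Nat.sub_add_comm h]
      exact hc _ _ _ (by omega)
  refine ⟨fun b => ⟨fun l => X b (l / (n + T)) (l % (n + T)), fun l => ?_⟩, fun b k => ?_⟩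
  · have hr := Nat.mod_lt l (show n + T > 0 by omega)
    have h1 := hX1 b (l / (n + T)) _ hr
    have hl := Nat.div_add_mod l (n + T)
    by_cases h : l % (n + T) + 1 = n + T
    · rw [h, hXT] at h1
      have e : l + 1 = (n + T) * (l / (n + T) + 1) := by rw [mul_add]; omega
      simp only [e, Nat.mul_mod_right, Nat.mul_div_cancel_left _ (show 0 < n + T by omega)]
      exact h1
    · have e : l + 1 = (n + T) * (l / (n + T)) + (l % (n + T) + 1) := by omega
      have e1 : (l + 1) / (n + T) = l / (n + T) := by
        rw [e, Nat.mul_add_div (by omega),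
          Nat.div_eq_of_lt (show l % (n + T) + 1 < n + T by omega), add_zero]
      have e2 : (l + 1) % (n + T) = l % (n + T) + 1 := by
        rw [e, Nat.mul_add_mod, Nat.mod_eq_of_lt (show l % (n + T) + 1 < n + T by omega)]
      simp only [e1, e2]
      exact h1
  · refine Subtype.ext (funext fun r => ?_)
    have hr := r.2
    have e1 : (k * (n + T) + r) / (n + T) = k := by
      rw [mul_comm, Nat.mul_add_div (by omega), Nat.div_eq_of_lt (by omega), add_zero]
    have e2 : (k * (n + T) + r) % (n + T) = r := by
      rw [mul_comm, Nat.mul_add_mod, Nat.mod_eq_of_lt (by omega)]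
    simp only [factor, e1, e2, X, dif_pos hr]

end IFS

/-! ### The lower bound of large deviations along words -/

namespace IFS

variable {N : ℕ} {S : IFS N} {f g : ℝ → ℝ} {R Q : ℕ → ℝ} {C D : ℝ}

/-- Each of the `k` periods costs `R n` for restarting its block and `T * C` for its connecting
path; the incomplete last period costs `r * C`. -/
theorem IsVariation.abs_blockSum_sub_sum_le (hR : S.IsVariation f R)
    (hC : ∀ p ∈ S.domain, |f p| ≤ C) (x : S.Seq) (n T k r : ℕ) :
    |S.blockSum f x.1 0 (k * (n + T) + r) -
      ∑ i ∈ Finset.range k, S.wordSum f n (S.factor x (i * (n + T)) n)| ≤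
      k * (R n + T * C) + r * C := by
  have key : |S.blockSum f x.1 0 (k * (n + T)) -
      ∑ i ∈ Finset.range k, S.wordSum f n (S.factor x (i * (n + T)) n)| ≤
      k * (R n + T * C) := by
    induction k with
    | zero => simp [blockSum]
    | succ k ih =>
      rw [Finset.sum_range_succ, _root_.add_mul, one_mul, ← add_assoc, blockSum_add, blockSum_add]
      have h1 := hR.abs_blockSum_sub_le x (k * (n + T)) n
      have h2 := S.abs_blockSum_le hC x (k * (n + T) + n) T
      simp only [zero_add]
      push_cast
      rw [abs_le] at *
      constructor <;> linarith [h1.1, h1.2, h2.1, h2.2, ih.1, ih.2]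
  rw [blockSum_add]
  have h2 := S.abs_blockSum_le hC x (k * (n + T)) r
  simp only [zero_add]
  rw [abs_le] at *
  constructor <;> linarith [h2.1, h2.2, key.1, key.2]

open Classical in
/-- If the Gibbs mean of `f` over the words of length `n` is `s`, then concatenation of such words
gives many long words along which the average of `f` is close to `s`. -/
theorem le_sum_words_of_mean_eq (hR : S.IsVariation f R) (hQ : S.IsVariation g Q)
    (hC : ∀ p ∈ S.domain, |f p| ≤ C) (hD : ∀ p ∈ S.domain, |g p| ≤ D) (hC0 : 0 ≤ C)
    (hD0 : 0 ≤ D) {n T : ℕ} (hn : 1 ≤ n) {glue : (ℕ → S.Word n) → S.Seq}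
    (hglue : ∀ b k, S.factor (glue b) (k * (n + T)) n = b k) {β s η : ℝ} (hη : 0 < η)
    (h0 : ∑ w : S.Word n, Real.exp (S.wordSum g n w + β * (S.wordSum f n w - n * s)) *
      (S.wordSum f n w - n * s) = 0) :
    ∀ᶠ k : ℕ in atTop, ∀ r < n + T,
      (∑ w : S.Word n, Real.exp (S.wordSum g n w + β * (S.wordSum f n w - n * s))) ^ k / 2 *
        Real.exp (-(k * (Q n + T * D + |β| * (n * η)) + (n + T) * D)) ≤
      ∑ w : S.Word (k * (n + T) + r),
        if |S.wordSum f _ w - (k * (n + T) + r : ℕ) * s| ≤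
            k * (n * η + R n + T * (C + |s|)) + (n + T) * (C + |s|)
          then Real.exp (S.wordSum g _ w) else 0 := by
  have hn' : (0 : ℝ) < n := by exact_mod_cast hn
  set X : S.Word n → ℝ := fun w => S.wordSum f n w - n * s
  set q : S.Word n → ℝ := fun w => Real.exp (S.wordSum g n w + β * X w)
  have hX : ∀ w, |X w| ≤ n * (C + |s|) := fun w => by
    refine (abs_sub _ _).trans ?_
    rw [abs_mul, Nat.abs_cast, mul_add]
    gcongr
    exact S.abs_wordSum_le hC n w
  -- The variance grows like `k` and the squared threshold `(k * (n * η)) ^ 2` like `k ^ 2`, so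
  -- Chebyshev's inequality applies for large `k`.
  have hlim : Tendsto (fun k : ℕ => (k : ℝ) * (n * η) ^ 2) atTop atTop :=
    tendsto_natCast_atTop_atTop.atTop_mul_const (by positivity)
  filter_upwards [hlim.eventually (eventually_ge_atTop (2 * (n * (C + |s|)) ^ 2)),
    eventually_ge_atTop 1] with k hk hk1 r hr
  have hk' : (0 : ℝ) < k := by exact_mod_cast hk1
  have cheb := le_sum_pi_prod_of_abs_sum_lt (fun w => (Real.exp_pos _).le) hX h0 k
    (a := k * (n * η)) (by positivity) (by
      calc 2 * (k * (n * (C + |s|)) ^ 2) = k * (2 * (n * (C + |s|)) ^ 2) := by ring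
        _ ≤ k * (k * (n * η) ^ 2) := by gcongr
        _ = _ := by ring)
  let ext : (Fin k → S.Word n) → ℕ → S.Word n := fun b i =>
    if h : i < k then b ⟨i, h⟩ else Classical.arbitrary _
  let W : (Fin k → S.Word n) → S.Word (k * (n + T) + r) := fun b => S.factor (glue (ext b)) 0 _
  have hfac : ∀ b (i : Fin k), S.factor (glue (ext b)) (i * (n + T)) n = b i := fun b i => by
    rw [hglue]
    simp [ext]
  -- The period is fixed, so the blocks can be read off at known places of the concatenation.
  have hW : Function.Injective W := by
    intro b b' h
    funext i
    rw [← hfac b i, ← hfac b' i]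
    refine Subtype.ext (funext fun l => ?_)
    have hle : (i : ℕ) * (n + T) + (n + T) ≤ k * (n + T) := by
      rw [← Nat.succ_mul]
      exact Nat.mul_le_mul_right _ i.2
    have := S.factor_congr h (l := i * (n + T) + l) (by omega)
    simpa [factor] using this
  have hsum : ∀ (h : ℝ → ℝ) b, ∑ i ∈ Finset.range k,
      S.wordSum h n (S.factor (glue (ext b)) (i * (n + T)) n) = ∑ i, S.wordSum h n (b i) := by
    intro h b
    rw [Finset.sum_range]
    exact Finset.sum_congr rfl fun i _ => by rw [hfac]
  have hrr : (r : ℝ) ≤ n + T := by exact_mod_cast hr.le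
  let ψ : S.Word (k * (n + T) + r) → ℝ := fun w =>
    if |S.wordSum f _ w - (k * (n + T) + r : ℕ) * s| ≤
      k * (n * η + R n + T * (C + |s|)) + (n + T) * (C + |s|)
    then Real.exp (S.wordSum g _ w) else 0
  have hψ : ∀ w, 0 ≤ ψ w := fun w => by
    simp only [ψ]
    split_ifs
    · exact (Real.exp_pos _).le
    · exact le_rfl
  refine le_trans ?_ (sum_comp_le_sum_of_injective hW hψ)
  refine le_trans (mul_le_mul_of_nonneg_right cheb (Real.exp_pos _).le) ?_
  rw [Finset.sum_mul]
  refine Finset.sum_le_sum fun b _ => ?_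
  by_cases hb : |∑ i, X (b i)| < k * (n * η)
  swap
  · rw [if_neg hb, zero_mul]
    exact hψ _
  rw [if_pos hb]
  have hF := hR.abs_blockSum_sub_sum_le hC (glue (ext b)) n T k r
  have hG := hQ.abs_blockSum_sub_sum_le hD (glue (ext b)) n T k r
  rw [hsum, ← wordSum_factor] at hF hG
  have hXsum : ∑ i, X (b i) = ∑ i, S.wordSum f n (b i) - k * (n * s) := by
    simp [X, Finset.sum_sub_distrib]
  have hrC : r * C ≤ (n + T) * C := by gcongr
  have hrD : r * D ≤ (n + T) * D := by gcongr
  have hcond : |S.wordSum f _ (W b) - (k * (n + T) + r : ℕ) * s| ≤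
      k * (n * η + R n + T * (C + |s|)) + (n + T) * (C + |s|) := by
    have e : S.wordSum f _ (W b) - (k * (n + T) + r : ℕ) * s =
        (S.wordSum f _ (W b) - ∑ i, S.wordSum f n (b i)) + ∑ i, X (b i) - (k * T + r) * s := by
      rw [hXsum]
      push_cast
      ring
    have h1 : |(k * T + r) * s| ≤ k * T * |s| + (n + T) * |s| := by
      rw [abs_mul, abs_of_nonneg (by positivity : (0 : ℝ) ≤ k * T + r), _root_.add_mul]
      gcongr
    rw [e]
    refine (abs_sub _ _).trans ((add_le_add ((abs_add_le _ _).trans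
      (add_le_add hF hb.le)) h1).trans ?_)
    linarith
  rw [if_pos hcond, ← Real.exp_sum, ← Real.exp_add, Real.exp_le_exp, Finset.sum_add_distrib, ← Finset.mul_sum]
  -- On the Chebyshev event the tilt can be removed at this price.
  have h2 : β * ∑ i, X (b i) ≤ |β| * (k * (n * η)) := by
    refine (le_abs_self _).trans ?_
    rw [abs_mul]
    gcongr
  linarith [(abs_le.1 hG).1]

/-- Every value between the extreme averages is the mean of a Gibbs measure on the words of length
`n`, with a tilt that is bounded in `n`. -/
theorem exists_mean_eq (hf : ContinuousOn f S.domain) (hg : ContinuousOn g S.domain) {s : ℝ}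
    (h1 : S.fMin f < s) (h2 : s < S.fMax f) : ∃ B : ℝ, ∀ᶠ n : ℕ in atTop, ∃ β : ℝ, |β| ≤ B ∧
      ∑ w : S.Word n, Real.exp (S.wordSum g n w + β * (S.wordSum f n w - n * s)) *
        (S.wordSum f n w - n * s) = 0 := by
  obtain ⟨D, -, hD⟩ := S.exists_abs_le hg
  obtain ⟨w, hw⟩ := exists_words_tendsto_fMax hf
  obtain ⟨w', hw'⟩ := exists_words_tendsto_fMin hf
  obtain ⟨κ, hκ, hκ1, hκ2⟩ : ∃ κ > 0, s + κ < S.fMax f ∧ S.fMin f < s - κ := by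
    refine ⟨min (S.fMax f - s) (s - S.fMin f) / 2, half_pos (lt_min (by linarith) (by linarith)),
      ?_, ?_⟩
    · have := min_le_left (S.fMax f - s) (s - S.fMin f)
      linarith
    · have := min_le_right (S.fMax f - s) (s - S.fMin f)
      linarith
  have hZ := tendsto_log_wordZ hf hg 0
  refine ⟨(S.u f g 0 + 1 + D) / κ, ?_⟩
  filter_upwards [hw.eventually (lt_mem_nhds hκ1), hw'.eventually (gt_mem_nhds hκ2),
    hZ.eventually (gt_mem_nhds (lt_add_one _)), eventually_ge_atTop 1] with n a1 a2 a3 hn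
  have hn' : (0 : ℝ) < n := by exact_mod_cast hn
  rw [lt_div_iff₀ hn'] at a1
  rw [div_lt_iff₀ hn'] at a2 a3
  have hκn : 0 < κ * n := by positivity
  obtain ⟨β, hβ, hmin⟩ := exists_tilt_mean_eq_zero (S.wordSum g n)
    (fun w => S.wordSum f n w - n * s) (i := w n) (j := w' n) (by linarith) (by linarith)
  refine ⟨β, ?_, hβ⟩
  -- The tilted sum is minimal at `β`, hence at most the untilted one. At words whose average
  -- exceeds or falls below `s` by `κ`, this bounds `|β|`.
  have hle : ∀ v : S.Word n, S.wordSum g n v + β * (S.wordSum f n v - n * s) ≤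
      (S.u f g 0 + 1) * n := by
    intro v
    refine le_trans ?_ a3.le
    rw [Real.le_log_iff_exp_le (S.wordZ_pos _ _)]
    refine (Finset.single_le_sum (f := fun w : S.Word n =>
      Real.exp (S.wordSum g n w + β * (S.wordSum f n w - n * s)))
      (fun _ _ => (Real.exp_pos _).le) (Finset.mem_univ v)).trans ((hmin 0).trans (le_of_eq ?_))
    simp [wordZ]
  rw [le_div_iff₀ hκ]
  refine le_of_mul_le_mul_right ?_ hn'
  have b1 := hle (w n)
  have b2 := hle (w' n)
  have d1 := (abs_le.1 (S.abs_wordSum_le hD n (w n))).1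
  have d2 := (abs_le.1 (S.abs_wordSum_le hD n (w' n))).1
  rcases le_total 0 β with hb | hb
  · rw [abs_of_nonneg hb]
    have : β * (κ * n) ≤ β * (S.wordSum f n (w n) - n * s) :=
      mul_le_mul_of_nonneg_left (by linarith) hb
    linarith
  · rw [abs_of_nonpos hb]
    have : (-β) * (κ * n) ≤ (-β) * (n * s - S.wordSum f n (w' n)) :=
      mul_le_mul_of_nonneg_left (by linarith) (by linarith)
    linarith

-- Blocks of one fixed, large length `n` are repeated. Their distortion and connecting paths cost
-- little per letter, and the pressure bounds their partition function from below already at this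
-- length.
open Classical in
theorem eventually_exp_le_sum_wordSum (hf : ContinuousOn f S.domain)
    (hg : ContinuousOn g S.domain) {s : ℝ} (h1 : S.fMin f < s) (h2 : s < S.fMax f) {c δ : ℝ}
    (hc : c < -legendre (S.u f g) s) (hδ : 0 < δ) :
    ∀ᶠ m : ℕ in atTop, Real.exp (m * c) ≤ ∑ w : S.Word m,
      if |S.wordSum f m w - m * s| ≤ m * δ then Real.exp (S.wordSum g m w) else 0 := by
  obtain ⟨C, hC0, hC⟩ := S.exists_abs_le hf
  obtain ⟨D, hD0, hD⟩ := S.exists_abs_le hg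
  obtain ⟨R, hR⟩ := S.exists_isVariation hf
  obtain ⟨Q, hQ⟩ := S.exists_isVariation hg
  obtain ⟨T, hT, hglue⟩ := S.exists_concat
  obtain ⟨B, hB⟩ := exists_mean_eq hf hg h1 h2
  -- One `ξ` pays for removing the tilt and one for distortion and connecting paths; the rest keeps
  -- the rate strictly above `c`.
  obtain ⟨ξ, hξ, hcξ⟩ : ∃ ξ > 0, c + 4 * ξ = -legendre (S.u f g) s :=
    ⟨(-legendre (S.u f g) s - c) / 4, by linarith, by ring⟩
  obtain ⟨η, hη, hηδ, hηB⟩ : ∃ η > 0, η ≤ δ / 8 ∧ |B| * η ≤ ξ := by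
    refine ⟨min (δ / 8) (ξ / (|B| + 1)), lt_min (by positivity) (by positivity),
      min_le_left _ _, ?_⟩
    calc |B| * min (δ / 8) (ξ / (|B| + 1)) ≤ (|B| + 1) * (ξ / (|B| + 1)) := by
          gcongr
          · linarith
          · exact min_le_right _ _
      _ = ξ := by field_simp
  -- choice of the block length
  have l1 : Tendsto (fun n : ℕ => R n / n + T * (C + |s|) / n) atTop (𝓝 (0 + 0)) :=
    hR.tendsto.add (tendsto_const_div_atTop_nhds_zero_nat _)
  have l2 : Tendsto (fun n : ℕ => 2 * (Q n / n) + |B| * (R n / n) + (T * D + T * |c|) / n)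
      atTop (𝓝 (2 * 0 + |B| * 0 + 0)) :=
    ((hQ.tendsto.const_mul 2).add (hR.tendsto.const_mul |B|)).add
      (tendsto_const_div_atTop_nhds_zero_nat _)
  simp only [mul_zero, add_zero] at l1 l2
  obtain ⟨n, ⟨β, hβB, h0⟩, hl1, hl2, hn⟩ := (hB.and ((l1.eventually
    (gt_mem_nhds (show (0 : ℝ) < δ / 8 by positivity))).and ((l2.eventually
    (gt_mem_nhds hξ)).and (eventually_ge_atTop 1)))).exists
  have hn' : (0 : ℝ) < n := by exact_mod_cast hn
  obtain ⟨glue, hglue⟩ := hglue n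
  rw [← add_div, div_lt_iff₀ hn'] at hl1
  rw [← mul_div_assoc, ← mul_div_assoc, ← add_div, ← add_div, div_lt_iff₀ hn'] at hl2
  have hblock := le_sum_words_of_mean_eq hR hQ hC hD hC0 hD0 hn hglue hη h0
  set H := ∑ w : S.Word n, Real.exp (S.wordSum g n w + β * (S.wordSum f n w - n * s)) with hH
  have hHpos : 0 < H := Finset.sum_pos (fun _ _ => Real.exp_pos _) Finset.univ_nonempty
  have hRn := hR.nonneg (Classical.arbitrary _) n
  have hHlog : n * (c + 4 * ξ) - Q n - |B| * R n ≤ Real.log H := by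
    have hp := (hR.add_mul hQ β).mul_pressure_le (hasPressure_u hf hg β) hn
    have hHZ : Real.log H = Real.log (S.wordZ (fun x => g x + β * f x) n) - β * n * s := by
      rw [← Real.log_exp (β * n * s), ← Real.log_div (S.wordZ_pos _ _).ne' (Real.exp_pos _).ne',
        hH, wordZ, Finset.sum_div]
      congr 1
      refine Finset.sum_congr rfl fun w _ => ?_
      rw [wordSum_add_mul, ← Real.exp_sub]
      ring_nf
    have hv := (isGreatest_legendre hf hg h1 h2).2 ⟨β, rfl⟩
    simp only at hv
    have hBR : |β| * R n ≤ |B| * R n :=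
      mul_le_mul_of_nonneg_right (hβB.trans (le_abs_self B)) hRn
    have : (n : ℝ) * (c + 4 * ξ) ≤ n * (S.u f g β - β * s) := by
      gcongr
      linarith
    linarith
  -- the rate per block and the constant error
  set E := Real.log H - (Q n + T * D + |β| * (n * η)) with hE
  set K := (n + T) * D + Real.log 2 with hK
  have hEc : (n + T) * c < E := by
    have b1 : |β| * (n * η) ≤ n * ξ := by
      calc |β| * (n * η) = n * (|β| * η) := by ring
        _ ≤ n * (|B| * η) := mul_le_mul_of_nonneg_left
          (mul_le_mul_of_nonneg_right (hβB.trans (le_abs_self B)) hη.le) hn'.le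
        _ ≤ n * ξ := by gcongr
    have b2 : T * c ≤ T * |c| := by
      gcongr
      exact le_abs_self c
    have : 0 < n * ξ := by positivity
    linarith
  have hL : (0 : ℝ) < n + T := by positivity
  have hdiv : Tendsto (fun m : ℕ => m / (n + T)) atTop atTop :=
    Nat.tendsto_div_const_atTop (by omega)
  -- The surplus rate absorbs the constants: the incomplete last period and the factor `1 / 2` from
  -- Chebyshev.
  have hm1 : Tendsto (fun m : ℕ => (m : ℝ) * (E / (n + T) - c)) atTop atTop :=
    tendsto_natCast_atTop_atTop.atTop_mul_const (by
      rw [sub_pos, lt_div_iff₀ hL]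
      linarith)
  have hm2 : Tendsto (fun m : ℕ => (m : ℝ) * (δ / 2)) atTop atTop :=
    tendsto_natCast_atTop_atTop.atTop_mul_const (by positivity)
  filter_upwards [hdiv.eventually hblock, hm1.eventually (eventually_ge_atTop (|E| + K)),
    hm2.eventually (eventually_ge_atTop ((n + T) * (C + |s|)))] with m hm hmE hmδ
  have hr := Nat.mod_lt m (show n + T > 0 by omega)
  replace hm := hm (m % (n + T)) hr
  have hmeq : m / (n + T) * (n + T) + m % (n + T) = m := by
    rw [mul_comm]
    exact Nat.div_add_mod m (n + T)
  generalize m / (n + T) = k at hm hmeq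
  generalize m % (n + T) = r at hm hmeq hr
  subst hmeq
  have hr' : (r : ℝ) ≤ n + T := by exact_mod_cast hr.le
  push_cast at hmE hmδ
  refine (le_trans ?_ hm).trans (Finset.sum_le_sum fun w _ => ?_)
  · have e1 : H ^ k / 2 = Real.exp (k * Real.log H - Real.log 2) := by
      rw [Real.exp_sub, Real.exp_log two_pos, mul_comm, Real.exp_mul, Real.exp_log hHpos,
        Real.rpow_natCast]
    rw [e1, ← Real.exp_add, Real.exp_le_exp]
    have e2 : (k * (n + T) + r) * (E / (n + T)) = k * E + r / (n + T) * E := by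
      field_simp
    have e3 : r / (n + T) * E ≤ |E| := by
      refine (le_abs_self _).trans ?_
      rw [abs_mul, abs_of_nonneg (by positivity : (0 : ℝ) ≤ r / (n + T))]
      exact mul_le_of_le_one_left (abs_nonneg _) ((div_le_one hL).2 hr')
    rw [mul_sub, e2] at hmE
    push_cast
    simp only [hE, hK] at *
    linarith
  · split_ifs with ha hb hb
    · exact le_rfl
    · exfalso
      apply hb
      refine ha.trans ?_
      have : (k : ℝ) * (n * η + R n + T * (C + |s|)) ≤ k * (n * (δ / 4)) := by
        gcongr
        have : n * η ≤ n * (δ / 8) := by gcongr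
        linarith
      have p1 : (0 : ℝ) ≤ k * n * δ := by positivity
      have p2 : (0 : ℝ) ≤ k * T * δ := by positivity
      have p3 : (0 : ℝ) ≤ r * δ := by positivity
      push_cast
      linarith
    · exact (Real.exp_pos _).le
    · exact le_rfl

end IFS

/-! ### Restricted partition functions and the upper bound -/

namespace IFS

variable {N : ℕ} {S : IFS N} {f g : ℝ → ℝ}

open Classical in
/-- The part of the partition function of `g` over the words with the average of `f` in `J`. -/
def ZOn (e : S.Extension) (f g : ℝ → ℝ) (n : ℕ) (J : Set ℝ) : ℝ :=
  ∑ w : S.Word n, if (1 / (n : ℝ)) * S.birkhoff e f n w ∈ J then Real.exp (S.birkhoff e g n w)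
    else 0

theorem probAverage_eq (e : S.Extension) (f g : ℝ → ℝ) (n : ℕ) (J : Set ℝ) :
    S.probAverage e f g n J = ZOn e f g n J / S.Z e g n := by
  rw [probAverage, ZOn, Finset.sum_div]
  refine Finset.sum_congr rfl fun w _ => ?_
  split_ifs
  · rfl
  · rw [zero_div]

theorem ZOn_mono (e : S.Extension) (f g : ℝ → ℝ) (n : ℕ) {J J' : Set ℝ} (h : J ⊆ J') :
    ZOn e f g n J ≤ ZOn e f g n J' := by
  refine Finset.sum_le_sum fun w _ => ?_
  split_ifs with h1 h2 h2
  · exact le_rfl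
  · exact absurd (h h1) h2
  · exact (Real.exp_pos _).le
  · exact le_rfl

theorem ZOn_union_le (e : S.Extension) (f g : ℝ → ℝ) (n : ℕ) (J J' : Set ℝ) :
    ZOn e f g n (J ∪ J') ≤ ZOn e f g n J + ZOn e f g n J' := by
  rw [ZOn, ZOn, ZOn, ← Finset.sum_add_distrib]
  refine Finset.sum_le_sum fun w _ => ?_
  have := (Real.exp_pos (S.birkhoff e g n w)).le
  split_ifs with h h1 h2 h2 <;> first | linarith | exact (h.elim h1 h2).elim

theorem birkhoff_add_mul (e : S.Extension) (f g : ℝ → ℝ) (β : ℝ) (n : ℕ) (w : S.Word n) :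
    S.birkhoff e (fun x => g x + β * f x) n w = S.birkhoff e g n w + β * S.birkhoff e f n w := by
  simp only [birkhoff, Finset.sum_add_distrib, ← Finset.mul_sum]

theorem eventually_exp_le_ZOn (hf : ContinuousOn f S.domain) (hg : ContinuousOn g S.domain)
    {s : ℝ} (h1 : S.fMin f < s) (h2 : s < S.fMax f) {c : ℝ} (hc : c < -legendre (S.u f g) s)
    (e : S.Extension) {J : Set ℝ} (hJ : J ∈ 𝓝 s) :
    ∀ᶠ n : ℕ in atTop, Real.exp (n * c) ≤ ZOn e f g n J := by
  obtain ⟨δ, hδ, hball⟩ := Metric.mem_nhds_iff.1 hJ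
  obtain ⟨R, hR⟩ := S.exists_isVariation hf
  obtain ⟨Q, hQ⟩ := S.exists_isVariation hg
  obtain ⟨c', hc1, hc2⟩ := exists_between hc
  filter_upwards [eventually_exp_le_sum_wordSum hf hg h1 h2 hc2 (half_pos hδ),
    hR.tendsto.eventually (gt_mem_nhds (half_pos hδ)),
    hQ.tendsto.eventually (gt_mem_nhds (sub_pos.2 hc1)), eventually_ge_atTop 1] with n hn a1 a2 hn1
  have hn' : (0 : ℝ) < n := by exact_mod_cast hn1
  rw [div_lt_iff₀ hn'] at a1 a2
  have hle : Real.exp (n * c') ≤ ZOn e f g n J * Real.exp (Q n) := by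
    refine hn.trans ?_
    rw [ZOn, Finset.sum_mul]
    refine Finset.sum_le_sum fun w _ => ?_
    have b1 := abs_le.1 (hR.abs_birkhoff_sub_le e n w)
    have b2 := abs_le.1 (hQ.abs_birkhoff_sub_le e n w)
    split_ifs with m1 m2 m2
    · rw [← Real.exp_add, Real.exp_le_exp]
      linarith
    · refine absurd (hball ?_) m2
      rw [abs_le] at m1
      rw [Metric.mem_ball, Real.dist_eq,
        show 1 / (n : ℝ) * S.birkhoff e f n w - s = (S.birkhoff e f n w - n * s) / n by field_simp,
        abs_div, Nat.abs_cast, div_lt_iff₀ hn', abs_lt]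
      constructor <;> linarith
    · positivity
    · simp
  refine le_of_mul_le_mul_right (le_trans ?_ hle) (Real.exp_pos (Q n))
  rw [← Real.exp_add, Real.exp_le_exp]
  linarith

/-- The upper bound of large deviations for compact sets. -/
theorem exists_eventually_ZOn_le (hf : ContinuousOn f S.domain) (hg : ContinuousOn g S.domain)
    (e : S.Extension) {J : Set ℝ} (hJ : IsCompact J) {c : ℝ}
    (hc : ∀ s ∈ J, ∃ β, S.u f g β - β * s < c) :
    ∃ K : ℝ, ∀ᶠ n : ℕ in atTop, ZOn e f g n J ≤ K * Real.exp (n * c) := by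
  refine hJ.induction_on (p := fun J => ∃ K : ℝ, ∀ᶠ n : ℕ in atTop,
    ZOn e f g n J ≤ K * Real.exp (n * c)) ⟨0, by simp [ZOn]⟩ ?_ ?_ ?_
  · rintro s t hst ⟨K, hK⟩
    exact ⟨K, hK.mono fun n hn => (ZOn_mono e f g n hst).trans hn⟩
  · rintro s t ⟨K, hK⟩ ⟨K', hK'⟩
    refine ⟨K + K', ?_⟩
    filter_upwards [hK, hK'] with n h1 h2
    have := ZOn_union_le e f g n s t
    linarith
  · intro s hs
    obtain ⟨β, hβ⟩ := hc s hs
    obtain ⟨d, hd1, hd2⟩ := exists_between hβ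
    -- On this open set, a half-line when `β ≠ 0`, the weight of `g` is at most that of `g + β * f`
    -- times `exp (n * (d - u β))`. The slack `c - d` covers the convergence of the pressure.
    refine ⟨{σ | S.u f g β - β * σ < d}, mem_nhdsWithin_of_mem_nhds
      ((isOpen_lt (by fun_prop) continuous_const).mem_nhds hd1), 1, ?_⟩
    filter_upwards [(hasPressure_u hf hg β e).eventually
      (gt_mem_nhds (show S.u f g β < S.u f g β + (c - d) by linarith)),
      eventually_ge_atTop 1] with n hn hn1
    have hn' : (0 : ℝ) < n := by exact_mod_cast hn1
    rw [one_div, ← div_eq_inv_mul, div_lt_iff₀ hn', Real.log_lt_iff_lt_exp (S.Z_pos e _ n)] at hn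
    calc ZOn e f g n {σ | S.u f g β - β * σ < d}
        ≤ S.Z e (fun x => g x + β * f x) n * Real.exp (n * (d - S.u f g β)) := by
          rw [ZOn, Z, Finset.sum_mul]
          refine Finset.sum_le_sum fun w _ => ?_
          rw [birkhoff_add_mul, ← Real.exp_add]
          split_ifs with h
          · rw [Real.exp_le_exp]
            have h' : S.u f g β - β * (1 / (n : ℝ) * S.birkhoff e f n w) < d := h
            have h3 := mul_lt_mul_of_pos_left h' hn'
            have h4 : (n : ℝ) * (S.u f g β - β * (1 / (n : ℝ) * S.birkhoff e f n w)) =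
              n * S.u f g β - β * S.birkhoff e f n w := by field_simp
            linarith
          · exact (Real.exp_pos _).le
      _ ≤ Real.exp ((S.u f g β + (c - d)) * n) * Real.exp (n * (d - S.u f g β)) := by gcongr
      _ = 1 * Real.exp (n * c) := by
          rw [← Real.exp_add, one_mul]
          ring_nf

theorem u_le_add_mul (hf : ContinuousOn f S.domain) (hg : ContinuousOn g S.domain) {β : ℝ}
    {b : ℕ → ℝ} {κ : ℝ} (hb : Tendsto b atTop (𝓝 κ)) (e : S.Extension)
    (h : ∀ (n : ℕ) w, β * (1 / (n : ℝ) * S.birkhoff e f n w) ≤ β * b n) :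
    S.u f g β ≤ S.u f g 0 + β * κ := by
  refine le_of_tendsto_of_tendsto (hasPressure_u hf hg β e)
    ((hasPressure_u hf hg 0 e).add (hb.const_mul β)) ?_
  filter_upwards [eventually_ge_atTop 1] with n hn
  have hn' : (0 : ℝ) < n := by exact_mod_cast hn
  have := log_sum_exp_sub_le (F := S.birkhoff e (fun x => g x + β * f x) n)
    (G := S.birkhoff e (fun x => g x + 0 * f x) n) (r := n * (β * b n)) fun w => by
      have h1 := mul_le_mul_of_nonneg_left (h n w) hn'.le
      have h2 : (n : ℝ) * (β * (1 / (n : ℝ) * S.birkhoff e f n w)) = β * S.birkhoff e f n w := by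
        field_simp
      rw [birkhoff_add_mul, birkhoff_add_mul]
      linarith
  rw [one_div, ← div_eq_inv_mul, ← div_eq_inv_mul, div_add' _ _ _ hn'.ne']
  refine div_le_div_of_nonneg_right ?_ hn'.le
  rw [mul_comm (β * b n)]
  exact this

theorem u_le_add_mul_fMax (hf : ContinuousOn f S.domain) (hg : ContinuousOn g S.domain) {β : ℝ}
    (hβ : 0 ≤ β) : S.u f g β ≤ S.u f g 0 + β * S.fMax f :=
  let e := Classical.arbitrary S.Extension
  u_le_add_mul hf hg (hasMaxAverage_fMax hf e) e fun (n : ℕ) w => mul_le_mul_of_nonneg_left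
    (le_ciSup (f := fun w => 1 / (n : ℝ) * S.birkhoff e f n w) (finite_range _).bddAbove w) hβ

theorem u_le_add_mul_fMin (hf : ContinuousOn f S.domain) (hg : ContinuousOn g S.domain) {β : ℝ}
    (hβ : β ≤ 0) : S.u f g β ≤ S.u f g 0 + β * S.fMin f :=
  let e := Classical.arbitrary S.Extension
  u_le_add_mul hf hg (hasMinAverage_fMin hf e) e fun (n : ℕ) w => mul_le_mul_of_nonpos_left
    (ciInf_le (f := fun w => 1 / (n : ℝ) * S.birkhoff e f n w) (finite_range _).bddBelow w) hβ

/-- Outside the closed interval of averages the linear upper bounds for `u` force `u β - β * s` to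
`-∞`. The tilt `x` (or `-x`) in the proof brings it down to `c - 1` or less. -/
theorem mem_Icc_of_forall_le (hf : ContinuousOn f S.domain) (hg : ContinuousOn g S.domain)
    {c s : ℝ} (h : ∀ β, c ≤ S.u f g β - β * s) : s ∈ Icc (S.fMin f) (S.fMax f) := by
  have h0 : 0 ≤ S.u f g 0 - c := by linarith [h 0]
  constructor
  · by_contra! hs
    have hd := sub_pos.2 hs
    set x := (S.u f g 0 - c + 1) / (S.fMin f - s) with hx
    have hxn : 0 ≤ x := by positivity
    have h1 : x * (S.fMin f - s) = S.u f g 0 - c + 1 := by rw [hx]; field_simp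
    have h2 := h (-x)
    have h3 := u_le_add_mul_fMin hf hg (neg_nonpos.2 hxn)
    linarith
  · by_contra! hs
    have hd := sub_pos.2 hs
    set x := (S.u f g 0 - c + 1) / (s - S.fMax f) with hx
    have hxn : 0 ≤ x := by positivity
    have h1 : x * (s - S.fMax f) = S.u f g 0 - c + 1 := by rw [hx]; field_simp
    have h2 := h x
    have h3 := u_le_add_mul_fMax hf hg hxn
    linarith

/-! ### The rate of a window and its limit as the window shrinks -/

/-- The values of `-v` at the admissible averages at distance less than `ε` from `t`. -/
def rates (S : IFS N) (f g : ℝ → ℝ) (t ε : ℝ) : Set ℝ :=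
  (fun s => -legendre (S.u f g) s) '' (Ioo (t - ε) (t + ε) ∩ Ioo (S.fMin f) (S.fMax f))

theorem le_of_mem_rates (hf : ContinuousOn f S.domain) (hg : ContinuousOn g S.domain)
    {t ε x : ℝ} (hx : x ∈ rates S f g t ε) {β : ℝ} :
    x ≤ S.u f g β - β * t + |β| * ε := by
  obtain ⟨s, ⟨hs1, hs2⟩, rfl⟩ := hx
  have h1 := (isGreatest_legendre hf hg hs2.1 hs2.2).2 ⟨β, rfl⟩
  have h2 : β * (t - s) ≤ |β| * ε := by
    refine (le_abs_self _).trans ?_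
    rw [abs_mul]
    gcongr
    rw [abs_le]
    constructor <;> linarith [hs1.1, hs1.2]
  simp only at h1 ⊢
  linarith

theorem bddAbove_rates (hf : ContinuousOn f S.domain) (hg : ContinuousOn g S.domain) (t ε : ℝ) :
    BddAbove (rates S f g t ε) :=
  ⟨_, fun _ hx => le_of_mem_rates hf hg hx (β := 0)⟩

theorem neg_legendre_mem_rates {t ε : ℝ} (hε : 0 < ε) (h1 : S.fMin f < t) (h2 : t < S.fMax f) :
    -legendre (S.u f g) t ∈ rates S f g t ε :=
  ⟨t, ⟨⟨by linarith, by linarith⟩, h1, h2⟩, rfl⟩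

/-- Boundary points of the window or of the interval of averages cannot beat the interior supremum.
Otherwise concavity of `-v` along the segment from `s` to the interior point `t` would give interior
values arbitrarily close to `c` or above. -/
theorem exists_sub_lt_of_sSup_rates_lt (hf : ContinuousOn f S.domain)
    (hg : ContinuousOn g S.domain) {t ε c s : ℝ} (hε : 0 < ε) (h1 : S.fMin f < t)
    (h2 : t < S.fMax f) (hc : sSup (rates S f g t ε) < c) (hs : s ∈ Icc (t - ε) (t + ε)) :
    ∃ β, S.u f g β - β * s < c := by
  by_contra! hcon
  have hs' := mem_Icc_of_forall_le hf hg hcon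
  have hlim : Tendsto (fun x : ℝ => (1 - x) * c + x * (-legendre (S.u f g) t)) (𝓝[>] 0)
      (𝓝 ((1 - 0) * c + 0 * (-legendre (S.u f g) t))) :=
    (Continuous.tendsto (by fun_prop) 0).mono_left nhdsWithin_le_nhds
  simp only [sub_zero, one_mul, zero_mul, add_zero] at hlim
  obtain ⟨x, hxc, hx0, hx1⟩ := ((hlim.eventually (lt_mem_nhds hc)).and
    (Ioo_mem_nhdsGT (zero_lt_one' ℝ))).exists
  have hmem : -legendre (S.u f g) ((1 - x) * s + x * t) ∈ rates S f g t ε := by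
    have p1 := mul_nonneg (sub_pos.2 hx1).le (sub_nonneg.2 hs.1)
    have p2 := mul_nonneg (sub_pos.2 hx1).le (sub_nonneg.2 hs.2)
    have p3 := mul_nonneg (sub_pos.2 hx1).le (sub_nonneg.2 hs'.1)
    have p4 := mul_nonneg (sub_pos.2 hx1).le (sub_nonneg.2 hs'.2)
    have q1 := mul_pos hx0 hε
    have q2 := mul_pos hx0 (sub_pos.2 h1)
    have q3 := mul_pos hx0 (sub_pos.2 h2)
    refine ⟨_, ⟨⟨?_, ?_⟩, ?_, ?_⟩, rfl⟩ <;> linarith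
  have hle := le_csSup (bddAbove_rates hf hg t ε) hmem
  have hge : legendre (S.u f g) ((1 - x) * s + x * t) ≤
      -((1 - x) * c + x * (-legendre (S.u f g) t)) := by
    refine ciSup_le fun β => ?_
    have a1 := mul_le_mul_of_nonneg_left (hcon β) (sub_pos.2 hx1).le
    have a2 := mul_le_mul_of_nonneg_left ((isGreatest_legendre hf hg h1 h2).2 ⟨β, rfl⟩) hx0.le
    simp only at a2
    linarith
  linarith

theorem eventually_ZOn_pos (hf : ContinuousOn f S.domain) (hg : ContinuousOn g S.domain)
    {t ε : ℝ} (hε : 0 < ε) (h1 : S.fMin f < t) (h2 : t < S.fMax f) (e : S.Extension) :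
    ∀ᶠ n : ℕ in atTop, 0 < ZOn e f g n (Ico (t - ε) (t + ε)) :=
  (eventually_exp_le_ZOn hf hg h1 h2 (sub_one_lt _) e
    (Ico_mem_nhds (by linarith) (by linarith))).mono fun _ hn => (Real.exp_pos _).trans_le hn

theorem tendsto_log_ZOn (hf : ContinuousOn f S.domain) (hg : ContinuousOn g S.domain)
    {t ε : ℝ} (hε : 0 < ε) (h1 : S.fMin f < t) (h2 : t < S.fMax f) (e : S.Extension) :
    Tendsto (fun n : ℕ => 1 / (n : ℝ) * Real.log (ZOn e f g n (Ico (t - ε) (t + ε)))) atTop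
      (𝓝 (sSup (rates S f g t ε))) := by
  refine tendsto_order.2 ⟨fun a ha => ?_, fun a ha => ?_⟩
  · obtain ⟨_, ⟨s, ⟨hs1, hs2⟩, rfl⟩, hs⟩ :=
      exists_lt_of_lt_csSup ⟨_, neg_legendre_mem_rates hε h1 h2⟩ ha
    obtain ⟨c, hc1, hc2⟩ := exists_between hs
    filter_upwards [eventually_exp_le_ZOn hf hg hs2.1 hs2.2 hc2 e (Ico_mem_nhds hs1.1 hs1.2),
      eventually_ge_atTop 1] with n hn hn1
    have hn' : (0 : ℝ) < n := by exact_mod_cast hn1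
    rw [← Real.le_log_iff_exp_le ((Real.exp_pos _).trans_le hn)] at hn
    rw [one_div, ← div_eq_inv_mul, lt_div_iff₀ hn']
    have := mul_lt_mul_of_pos_left hc1 hn'
    linarith
  · obtain ⟨c, hc1, hc2⟩ := exists_between ha
    obtain ⟨K, hK⟩ := exists_eventually_ZOn_le hf hg e isCompact_Icc
      fun s hs => exists_sub_lt_of_sSup_rates_lt hf hg hε h1 h2 hc1 hs
    have hlim : Tendsto (fun n : ℕ => Real.log K / n + c) atTop (𝓝 (0 + c)) :=
      (tendsto_const_div_atTop_nhds_zero_nat _).add_const c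
    rw [zero_add] at hlim
    filter_upwards [hK, eventually_ZOn_pos hf hg hε h1 h2 e, hlim.eventually (gt_mem_nhds hc2),
      eventually_ge_atTop 1] with n hn hpos hna hn1
    have hn' : (0 : ℝ) < n := by exact_mod_cast hn1
    refine lt_of_le_of_lt ?_ hna
    -- The upper bound is for the compact window and the lower bound for interior points; the
    -- half-open window is caught in between.
    replace hn := (ZOn_mono e f g n Ico_subset_Icc_self).trans hn
    have hKpos : 0 < K := pos_of_mul_pos_left (hpos.trans_le hn) (Real.exp_pos _).le
    have := Real.log_le_log hpos hn
    rw [Real.log_mul hKpos.ne' (Real.exp_pos _).ne', Real.log_exp] at this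
    rw [one_div, ← div_eq_inv_mul, div_le_iff₀ hn', add_mul, div_mul_cancel₀ _ hn'.ne']
    linarith

theorem tendsto_sSup_rates (hf : ContinuousOn f S.domain) (hg : ContinuousOn g S.domain) {t : ℝ}
    (h1 : S.fMin f < t) (h2 : t < S.fMax f) :
    Tendsto (fun ε => sSup (rates S f g t ε)) (𝓝[>] 0) (𝓝 (-legendre (S.u f g) t)) := by
  -- The single `β` attaining the supremum at `t` bounds `-v` at all nearby points, with an error
  -- linear in `ε`.
  obtain ⟨β, hβ⟩ := (isGreatest_legendre hf hg h1 h2).1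
  have hlim : Tendsto (fun ε : ℝ => S.u f g β - β * t + |β| * ε) (𝓝[>] 0)
      (𝓝 (S.u f g β - β * t + |β| * 0)) :=
    (Continuous.tendsto (by fun_prop) 0).mono_left nhdsWithin_le_nhds
  rw [mul_zero, add_zero, show S.u f g β - β * t = -legendre (S.u f g) t by
    rw [← hβ]; ring] at hlim
  refine tendsto_of_tendsto_of_tendsto_of_le_of_le' tendsto_const_nhds hlim ?_ ?_
  · filter_upwards [self_mem_nhdsWithin] with ε hε
    exact le_csSup (bddAbove_rates hf hg t ε) (neg_legendre_mem_rates hε h1 h2)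
  · filter_upwards [self_mem_nhdsWithin] with ε hε
    refine csSup_le ⟨_, neg_legendre_mem_rates hε h1 h2⟩ fun x hx => ?_
    have := le_of_mem_rates hf hg hx (β := β)
    rw [← hβ]
    linarith

theorem hasRate (hf : ContinuousOn f S.domain) (hg : ContinuousOn g S.domain) {t : ℝ}
    (h1 : S.fMin f < t) (h2 : t < S.fMax f) :
    S.HasRate f g t ((-S.pressure g - legendre (S.u f g) t : ℝ) : EReal) := by
  intro e
  refine ⟨fun ε => ((sSup (rates S f g t ε) - S.pressure g : ℝ) : EReal), fun ε hε => ?_, ?_⟩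
  · have h := (tendsto_log_ZOn hf hg hε h1 h2 e).sub (hasPressure_pressure hg e)
    refine ((continuous_coe_real_ereal.tendsto _).comp h).congr' ?_
    -- Eventual positivity of the mass makes the extended logarithm an ordinary real one.
    filter_upwards [eventually_ZOn_pos hf hg hε h1 h2 e] with n hn
    have hZ := S.Z_pos e g n
    rw [probAverage_eq, ENNReal.log_ofReal_of_pos (div_pos hn hZ), ← EReal.coe_mul,
      Real.log_div hn.ne' hZ.ne', mul_sub]
    rfl
  · refine (continuous_coe_real_ereal.tendsto _).comp ?_
    have := (tendsto_sSup_rates hf hg h1 h2).sub_const (S.pressure g)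
    rwa [show -legendre (S.u f g) t - S.pressure g = -S.pressure g - legendre (S.u f g) t by
      ring] at this

end IFS

end

theorem propositionB3 {N : ℕ} (S : IFS N) (f g : ℝ → ℝ)
    (hf : ContinuousOn f S.domain) (hg : ContinuousOn g S.domain) :
    S.HasMinAverage f (S.fMin f) ∧ S.HasMaxAverage f (S.fMax f) ∧
    S.HasPressure g (S.pressure g) ∧
    (∀ β : ℝ, S.HasPressure (fun x => g x + β * f x) (S.u f g β)) ∧
    ∀ t : ℝ, S.fMin f < t → t < S.fMax f →
      IsGreatest (Set.range fun β : ℝ => β * t - S.u f g β) (legendre (S.u f g) t) ∧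
      (∀ β : ℝ, HasDerivAt (S.u f g) t β → legendre (S.u f g) t = β * t - S.u f g β) ∧
      (Differentiable ℝ (S.u f g) → ∃ β : ℝ, HasDerivAt (S.u f g) t β) ∧
      S.HasRate f g t ((-S.pressure g - legendre (S.u f g) t : ℝ) : EReal) :=
  ⟨IFS.hasMinAverage_fMin hf, IFS.hasMaxAverage_fMax hf, IFS.hasPressure_pressure hg,
    IFS.hasPressure_u hf hg, fun _ h1 h2 => ⟨IFS.isGreatest_legendre hf hg h1 h2,
      fun _ h => IFS.legendre_eq_of_hasDerivAt hf hg h,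
      IFS.exists_hasDerivAt hf hg h1 h2, IFS.hasRate hf hg h1 h2⟩⟩
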